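/- Let $\mathcal I$ be a finite index set with $|\mathcal I|\ge 2$ and let $S_i(x,y)=(c_i x,d_i y)+(a_i,b_i)$, $i\in\mathcal I$, with $c_i,d_i\in(0,1)$ and $(a_i,b_i)\in\mathbb R^2$, be an iterated function system on $[0,1]^2$ in one of the following classes. (LG) *Extended Lalley–Gatzouras class.* The unit square is divided into at least two columns by vertical lines, each column is divided independently by horizontal lines, and the $S_i$ map $[0,1]^2$ onto distinct rectangles of this division, each having base at least as long as its height; or the same with the two coordinate axes interchanged. (B) *Barański class.* The unit square is divided into rectangles by finitely many vertical and horizontal lines (at least one in each direction), and the $S_i$ map $[0,1]^2$ onto distinct rectangles of this division. Assume that at least one $S_i$ is not a similarity, and let $F$ be the attractor (a *self-affine carpet*), i.e. the unique non-empty compact set with $F=\bigcup_{i\in\mathcal I}S_i(F)$. Say that $F$ is of *horizontal type* if $c_i\ge d_i$ for all $i$, of *vertical type* if $c_i\le d_i$ for all $i$, and of *mixed type* otherwise. Let $\pi_1,\pi_2$ be the projections to the horizontal and vertical axes, and let $\mathrm{Slice}_{1,i}(F)$ and $\mathrm{Slice}_{2,i}(F)$ be, respectively, the vertical and the horizontal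 slice of $F$ through the fixed point of $S_i$. For a set $E$ in a metric space let $N_r(E)$ be the smallest number of open sets of diameter at most $r$ needed to cover $E$, let $\dim_{\mathrm B}E=\lim_{r\to0}\log N_r(E)/(-\log r)$ be the box dimension, when this limit exists, and let $$\dim_{\mathrm L}F=\sup\Big\{\alpha:\ \exists\,C,\rho>0\ \ \forall\,0<r<R\le\rho:\ \inf_{x\in F}N_r\big(B(x,R)\cap F\big)\ge C\Big(\frac Rr\Big)^{\alpha}\Big\}$$ be the lower dimension, where $B(x,R)$ is the closed ball. Then the following holds, where all the box dimensions occurring in the formula for the respective type exist. If $F$ is of horizontal type, then $$\dim_{\mathrm L}F=\dim_{\mathrm B}\pi_1(F)+\min_{i\in\mathcal I}\dim_{\mathrm B}\mathrm{Slice}_{1,i}(F);$$ if $F$ is of vertical type, then $$\dim_{\mathrm L}F=\dim_{\mathrm B}\pi_2(F)+\min_{i\in\mathcal I}\dim_{\mathrm B}\mathrm{Slice}_{2,i}(F);$$ and if $F$ is of mixed type, then $$\dim_{\mathrm L}F=\min_{i\in\mathcal I}\ \min_{j=1,2}\Big(\dim_{\mathrm B}\pi_j(F)+\dim_{\mathrm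 B}\mathrm{Slice}_{j,i}(F)\Big).$$ -/

import Mathlib

open Filter Topology
open scoped ENNReal

noncomputable section

namespace Carpet

/-! ### Covering numbers and dimensions -/

section Dimensions

variable {X : Type*} [PseudoEMetricSpace X]

/-- The covering number `N_r(E)`: the smallest number of open sets of diameter at most `r` required
to cover `E` (`⊤` if no finite family does). -/
def coverNumber (r : ℝ) (E : Set X) : ℕ∞ :=
  ⨅ (𝒰 : Set (Set X)) (_ : ∀ U ∈ 𝒰, IsOpen U ∧ Metric.ediam U ≤ ENNReal.ofReal r)
    (_ : E ⊆ ⋃₀ 𝒰), 𝒰.encard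

/-- `log N_r(E) / (- log r)`, as an extended real number. -/
def boxRatio (E : Set X) (r : ℝ) : EReal :=
  ENNReal.log (coverNumber r E : ℝ≥0∞) / ((-Real.log r : ℝ) : EReal)

/-- The lower box dimension. -/
def lowerBoxDim (E : Set X) : EReal := liminf (boxRatio E) (𝓝[>] (0 : ℝ))

/-- The upper box dimension. -/
def upperBoxDim (E : Set X) : EReal := limsup (boxRatio E) (𝓝[>] (0 : ℝ))

/-- The box dimension of `E` exists (lower and upper box dimension agree) and equals the real
number `s`. -/
def HasBoxDim (E : Set X) (s : ℝ) : Prop :=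
  lowerBoxDim E = (s : EReal) ∧ upperBoxDim E = (s : EReal)

end Dimensions

/-- The exponents `α` admitted in the definition of the lower dimension: there are `C, ρ > 0` with
`N_r(B(x,R) ∩ F) ≥ C (R/r)^α` for all `0 < r < R ≤ ρ` and all `x ∈ F`. -/
def lowerExponents {X : Type*} [PseudoMetricSpace X] (F : Set X) : Set ℝ :=
  {α | ∃ C : ℝ, 0 < C ∧ ∃ ρ : ℝ, 0 < ρ ∧ ∀ r R : ℝ, 0 < r → r < R → R ≤ ρ → ∀ x ∈ F,
    ENNReal.ofReal (C * (R / r) ^ α) ≤ (coverNumber r (Metric.closedBall x R ∩ F) : ℝ≥0∞)}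

/-- The lower dimension of `F`. -/
def lowerDim {X : Type*} [PseudoMetricSpace X] (F : Set X) : EReal :=
  sSup ((fun α : ℝ => (α : EReal)) '' lowerExponents F)

/-! ### Self-affine carpets -/

/-- The Euclidean plane; coordinate `0` is horizontal, coordinate `1` is vertical. -/
abbrev Plane : Type := EuclideanSpace ℝ (Fin 2)

/-- A family of maps `S_i(x,y) = (c_i x, d_i y) + (a_i, b_i)` of the plane with
`c_i = ratio i 0`, `d_i = ratio i 1` in `(0,1)` and `(a_i, b_i) = (shift i 0, shift i 1)`. -/
structure AffineIFS (ι : Type*) where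
  ratio : ι → Fin 2 → ℝ
  shift : ι → Fin 2 → ℝ
  ratio_mem : ∀ i j, ratio i j ∈ Set.Ioo (0 : ℝ) 1

/-- A division of `[0,1]` into `n` consecutive intervals by `0 = pts 0 < ⋯ < pts n = 1`. -/
structure Division where
  n : ℕ
  pts : Fin (n + 1) → ℝ
  strictMono : StrictMono pts
  pts_zero : pts 0 = 0
  pts_last : pts (Fin.last n) = 1

namespace Division

/-- The left end point of the `k`-th interval. -/
def left (P : Division) (k : Fin P.n) : ℝ := P.pts k.castSucc

/-- The length of the `k`-th interval. -/
def length (P : Division) (k : Fin P.n) : ℝ := P.pts k.succ - P.pts k.castSucc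

end Division

namespace AffineIFS

variable {ι : Type*} (S : AffineIFS ι)

/-- The map `S_i`. -/
def map (i : ι) (p : Plane) : Plane :=
  WithLp.toLp 2 (fun j => S.ratio i j * p j + S.shift i j)

/-- `F` is the attractor of the system: non-empty, compact and `F = ⋃ i, S_i(F)`. -/
def IsAttractor (F : Set Plane) : Prop :=
  F.Nonempty ∧ IsCompact F ∧ F = ⋃ i, S.map i '' F

/-- In coordinate `j`, the map `S_i` sends `[0,1]` onto the `k`-th interval of `P`, preserving
orientation. -/
def MapsOnto (i : ι) (j : Fin 2) (P : Division) (k : Fin P.n) : Prop :=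
  S.shift i j = P.left k ∧ S.ratio i j = P.length k

/-- The extended Lalley-Gatzouras class, where the strips are perpendicular to the axis `j` and
`j'` is the other coordinate. For `(j, j') = (0, 1)`: the square is divided into at least two
columns, each column is divided independently by horizontal lines, and the maps send the square
onto distinct chosen rectangles, each with base at least as long as its height.
For `(j, j') = (1, 0)`: the same with the two coordinate axes interchanged. -/
def IsExtendedLalleyGatzouras (j j' : Fin 2) : Prop :=
  ∃ (P : Division) (Q : Fin P.n → Division) (cell : ι → Σ k : Fin P.n, Fin (Q k).n),
    2 ≤ P.n ∧ Function.Injective cell ∧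
    ∀ i, S.MapsOnto i j P (cell i).1 ∧ S.MapsOnto i j' (Q (cell i).1) (cell i).2 ∧
      S.ratio i j' ≤ S.ratio i j

/-- The Barański class: the square is divided by vertical and horizontal lines, at least one in each
direction, and the maps send the square onto distinct chosen rectangles. -/
def IsBaranski : Prop :=
  ∃ (P Q : Division) (cell : ι → Fin P.n × Fin Q.n),
    2 ≤ P.n ∧ 2 ≤ Q.n ∧ Function.Injective cell ∧
    ∀ i, S.MapsOnto i 0 P (cell i).1 ∧ S.MapsOnto i 1 Q (cell i).2

/-- The system defines a self-affine carpet: it is in the extended Lalley-Gatzouras class (or its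
image under interchanging the axes) or in the Barański class, and at least one of its maps is not a
similarity. -/
def IsCarpetSystem : Prop :=
  (S.IsExtendedLalleyGatzouras 0 1 ∨ S.IsExtendedLalleyGatzouras 1 0 ∨ S.IsBaranski) ∧
  ∃ i, ¬ ∃ k : ℝ, ∀ p q : Plane, dist (S.map i p) (S.map i q) = k * dist p q

/-- Horizontal type: `c_i ≥ d_i` for all `i`. -/
def IsHorizontal : Prop := ∀ i, S.ratio i 1 ≤ S.ratio i 0

/-- Vertical type: `c_i ≤ d_i` for all `i`. -/
def IsVertical : Prop := ∀ i, S.ratio i 0 ≤ S.ratio i 1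

/-- Mixed type: neither horizontal nor vertical. -/
def IsMixed : Prop := ¬ S.IsHorizontal ∧ ¬ S.IsVertical

/-- The slice of `F` through the fixed point of `S_i` on which the coordinate `j` is constant: the
vertical slice for `j = 0`, the horizontal slice for `j = 1`. -/
def slice (j : Fin 2) (i : ι) (F : Set Plane) : Set Plane :=
  {p ∈ F | ∃ q : Plane, S.map i q = q ∧ p j = q j}

end AffineIFS

/-- The projection of `F` to the horizontal (`j = 0`) or vertical (`j = 1`) axis. -/
def proj (j : Fin 2) (F : Set Plane) : Set ℝ := (fun p : Plane => p j) '' F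

end Carpet

end

/-!
The count of boxes of a given size that meet a self-affine set is superadditive (for packings by
separated boxes, `PackGe`) and subadditive (for covers, `CoverLe`) along the maps of the system.
These two properties turn every estimate below into a recursion that divides the sides of the boxes
by the ratios of the maps, and both counts are comparable with covering numbers by sets of small
diameter (`PackGe.le_coverNumber`, `CoverLe.coverNumber_le`). For self-similar sets on the line the
recursion gives the box dimension as the root of `∑ c_i ^ s = 1`; this applies to the projections
and, since the abscissa of the fixed point of a map lies in one column only, to the slices.

In the plane, the argument for one direction is carried out for a `ColumnCarpet`, a system organised
in non-overlapping columns; with the coordinates interchanged, it also covers the other direction.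
Let `s` be the dimension of the projection to the horizontal axis, and `t_k` that of the slices in
the column `k`.

*Lower bound.* Zoom in on a box about a point of the carpet by the maps that code the point, until
one of the sides reaches the unit scale (`packGe_zoom`). If this is the vertical side, then the box
has become a vertical strip. The recursion in a strip uses the maps of one column at a time, whose
heights satisfy `∑ d_i ^ t ≥ 1` for `t = min t_k`, until the strip is as wide as the square; from
then on it uses all maps, for which `∑ c_i ^ s * d_i ^ t ≥ 1` (`packGe_vstrip`). This gives
`λ ^ (s + t)` boxes whose sides are `λ` times smaller than those of the strip. If no rectangle is
higher than wide, then the vertical side is always the first; in the mixed case the horizontal side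
may be the first, and then the estimate holds with the axes interchanged.

*Upper bound.* Choose a map `f_i` whose rectangle is wider than high, and of least height in its
column. The `n`-fold rectangle of `f_i` is much wider than high, so that a square with side
comparable with its height sees, in the rectangle, only a narrow column of the carpet, and this
column can be taken to be a deep iterate of the column `k`. The part of the carpet in the square is
then covered by about `λ ^ (s + t_k)` squares that are `λ` times smaller (`coverLe_iterate`, `exists_coverLe_inBox`). The
square is placed so that it meets no other rectangle of the `n`-fold column
(`mem_image_iterate_of_near`).
-/

noncomputable section

namespace Carpet

/-! ### Packing and covering by boxes -/

section Boxes

variable {J : Type*}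

/-- The coordinatewise affine map `p ↦ (c_j p_j + a_j)_j`. -/
def boxMap (c a : J → ℝ) (p : J → ℝ) : J → ℝ := fun j => c j * p j + a j

/-- `K` meets at least `X` boxes with sides `δ` inside the unit cube, whose corners are
`δ`-separated. The finset `T` lists the lower corners `p` of the boxes `∏ [p_j, p_j + δ_j]`. -/
def PackGe (K : Set (J → ℝ)) (δ : J → ℝ) (X : ℝ) : Prop :=
  ∃ T : Finset (J → ℝ), (∀ p ∈ T, ∀ j, 0 ≤ p j ∧ p j + δ j ≤ 1) ∧
    (∀ p ∈ T, ∃ x ∈ K, ∀ j, p j ≤ x j ∧ x j ≤ p j + δ j) ∧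
    (∀ p ∈ T, ∀ q ∈ T, p ≠ q → ∃ j, δ j ≤ |p j - q j|) ∧ X ≤ T.card

/-- `K` is covered by at most `X` boxes with sides `δ`. -/
def CoverLe (K : Set (J → ℝ)) (δ : J → ℝ) (X : ℝ) : Prop :=
  ∃ T : Finset (J → ℝ), (∀ x ∈ K, ∃ p ∈ T, ∀ j, p j ≤ x j ∧ x j ≤ p j + δ j) ∧ T.card ≤ X

/-- The set of `j`-th coordinates of `K`, as a subset of the one-dimensional cube space. -/
def shadow (j : J) (K : Set (J → ℝ)) : Set (Unit → ℝ) := {p | ∃ x ∈ K, x j = p ()}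

/-- The points of `K` in the closed box with centre `x` and half-sides `α`. -/
def inBox (K : Set (J → ℝ)) (x α : J → ℝ) : Set (J → ℝ) := {p ∈ K | ∀ j, |p j - x j| ≤ α j}

lemma PackGe.mono {K L : Set (J → ℝ)} {δ : J → ℝ} {X Y : ℝ} (h : PackGe K δ X) (hKL : K ⊆ L)
    (hXY : Y ≤ X) : PackGe L δ Y := by
  obtain ⟨T, h1, h2, h3, h4⟩ := h
  exact ⟨T, h1, fun p hp => (h2 p hp).imp fun x hx => ⟨hKL hx.1, hx.2⟩, h3, hXY.trans h4⟩

lemma CoverLe.mono {K L : Set (J → ℝ)} {δ : J → ℝ} {X Y : ℝ} (h : CoverLe K δ X) (hKL : L ⊆ K)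
    (hXY : X ≤ Y) : CoverLe L δ Y := by
  obtain ⟨T, h1, h2⟩ := h
  exact ⟨T, fun x hx => h1 x (hKL hx), h2.trans hXY⟩

/-- Packing counts are superadditive: images of packings under maps of the unit cube onto
non-overlapping boxes form a packing. -/
lemma PackGe.iUnion {I : Type*} [Fintype I] {c a : I → J → ℝ} (hc : ∀ i j, 0 < c i j)
    (ha : ∀ i j, 0 ≤ a i j) (hac : ∀ i j, a i j + c i j ≤ 1)
    (hsep : ∀ i i', i ≠ i' → ∃ j, a i j + c i j ≤ a i' j ∨ a i' j + c i' j ≤ a i j)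
    {K : Set (J → ℝ)} {L : I → Set (J → ℝ)} (hLK : ∀ i, ∀ x ∈ L i, boxMap (c i) (a i) x ∈ K)
    {δ : J → ℝ} (hδ : ∀ j, 0 < δ j) {X : I → ℝ} (h : ∀ i, PackGe (L i) (δ / c i) (X i)) :
    PackGe K δ (∑ i, X i) := by
  classical
  choose T h1 h2 h3 h4 using h
  have hbox : ∀ i, ∀ p ∈ T i, ∀ j, a i j ≤ boxMap (c i) (a i) p j ∧
      boxMap (c i) (a i) p j + δ j ≤ a i j + c i j := by
    intro i p hp j
    have h0 := h1 i p hp j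
    have hcc := hc i j
    simp only [Pi.div_apply] at h0
    have e : c i j * (δ j / c i j) = δ j := by field_simp
    simp only [boxMap]
    constructor
    · nlinarith
    · nlinarith
  have hinj : ∀ i, Function.Injective (boxMap (c i) (a i)) := by
    intro i p q hpq
    funext j
    have := congrFun hpq j
    simp only [boxMap, add_left_inj] at this
    exact mul_left_cancel₀ (hc i j).ne' this
  have hsepd : ∀ i i', i ≠ i' → ∀ p ∈ T i, ∀ q ∈ T i', ∃ j,
      δ j ≤ |boxMap (c i) (a i) p j - boxMap (c i') (a i') q j| := by
    intro i i' hii p hp q hq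
    obtain ⟨j, hj⟩ := hsep i i' hii
    have hp' := hbox i p hp j
    have hq' := hbox i' q hq j
    refine ⟨j, ?_⟩
    rcases hj with hj | hj
    · rw [abs_sub_comm]
      exact le_trans (by linarith) (le_abs_self _)
    · exact le_trans (by linarith) (le_abs_self _)
  refine ⟨Finset.univ.biUnion fun i => (T i).image (boxMap (c i) (a i)), ?_, ?_, ?_, ?_⟩
  · intro p hp j
    simp only [Finset.mem_biUnion, Finset.mem_univ, true_and, Finset.mem_image] at hp
    obtain ⟨i, q, hq, rfl⟩ := hp
    have := hbox i q hq j
    have := ha i j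
    have := hac i j
    constructor <;> linarith
  · intro p hp
    simp only [Finset.mem_biUnion, Finset.mem_univ, true_and, Finset.mem_image] at hp
    obtain ⟨i, q, hq, rfl⟩ := hp
    obtain ⟨x, hx, hqx⟩ := h2 i q hq
    refine ⟨_, hLK i x hx, fun j => ?_⟩
    have hj := hqx j
    have hcc := hc i j
    simp only [Pi.div_apply] at hj
    have e : c i j * (δ j / c i j) = δ j := by field_simp
    simp only [boxMap]
    constructor <;> nlinarith
  · intro p hp p' hp' hne
    simp only [Finset.mem_biUnion, Finset.mem_univ, true_and, Finset.mem_image] at hp hp'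
    obtain ⟨i, q, hq, rfl⟩ := hp
    obtain ⟨i', q', hq', rfl⟩ := hp'
    by_cases hii : i = i'
    · subst hii
      obtain ⟨j, hj⟩ := h3 i q hq q' hq' (fun e => hne (by rw [e]))
      refine ⟨j, ?_⟩
      have hcc := hc i j
      simp only [Pi.div_apply] at hj
      have e : boxMap (c i) (a i) q j - boxMap (c i) (a i) q' j = c i j * (q j - q' j) := by
        simp only [boxMap]; ring
      rw [e, abs_mul, abs_of_pos hcc]
      rwa [div_le_iff₀' hcc] at hj
    · exact hsepd i i' hii q hq q' hq'
  · rw [Finset.card_biUnion]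
    · push_cast
      refine Finset.sum_le_sum fun i _ => ?_
      rw [Finset.card_image_of_injective _ (hinj i)]
      exact h4 i
    · intro i _ i' _ hii
      refine Finset.disjoint_left.2 fun p hp hp' => ?_
      simp only [Finset.mem_image] at hp hp'
      obtain ⟨q, hq, rfl⟩ := hp
      obtain ⟨q', hq', e⟩ := hp'
      obtain ⟨j, hj⟩ := hsepd i i' hii q hq q' hq'
      rw [e, sub_self, abs_zero] at hj
      exact absurd (hδ j) (not_lt.2 hj)

lemma PackGe.image {c a : J → ℝ} (hc : ∀ j, 0 < c j) (ha : ∀ j, 0 ≤ a j)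
    (hac : ∀ j, a j + c j ≤ 1) {K L : Set (J → ℝ)} (hLK : ∀ x ∈ L, boxMap c a x ∈ K)
    {δ : J → ℝ} (hδ : ∀ j, 0 < δ j) {X : ℝ} (h : PackGe L (δ / c) X) : PackGe K δ X := by
  have := PackGe.iUnion (I := Unit) (c := fun _ => c) (a := fun _ => a) (fun _ => hc) (fun _ => ha)
    (fun _ => hac) (fun i i' h => absurd rfl h) (L := fun _ => L) (fun _ => hLK) hδ
    (X := fun _ => X) (fun _ => h)
  simpa using this

lemma CoverLe.iUnion {I : Type*} [Fintype I] {c a : I → J → ℝ} (hc : ∀ i j, 0 < c i j)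
    {K : Set (J → ℝ)} {L : I → Set (J → ℝ)}
    (hLK : ∀ p ∈ K, ∃ i, ∃ x ∈ L i, boxMap (c i) (a i) x = p)
    {δ : J → ℝ} {X : I → ℝ} (h : ∀ i, CoverLe (L i) (δ / c i) (X i)) :
    CoverLe K δ (∑ i, X i) := by
  classical
  choose T h1 h2 using h
  refine ⟨Finset.univ.biUnion fun i => (T i).image (boxMap (c i) (a i)), ?_, ?_⟩
  · intro p hp
    obtain ⟨i, x, hx, rfl⟩ := hLK p hp
    obtain ⟨q, hq, hqx⟩ := h1 i x hx
    refine ⟨boxMap (c i) (a i) q, ?_, fun j => ?_⟩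
    · simp only [Finset.mem_biUnion, Finset.mem_univ, true_and, Finset.mem_image]
      exact ⟨i, q, hq, rfl⟩
    have hj := hqx j
    have hcc := hc i j
    simp only [Pi.div_apply] at hj
    have e : c i j * (δ j / c i j) = δ j := by field_simp
    simp only [boxMap]
    constructor <;> nlinarith
  · refine le_trans (Nat.cast_le.2 Finset.card_biUnion_le) ?_
    push_cast
    refine Finset.sum_le_sum fun i _ => le_trans (Nat.cast_le.2 Finset.card_image_le) (h2 i)

lemma CoverLe.image {c a : J → ℝ} (hc : ∀ j, 0 < c j) {K L : Set (J → ℝ)}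
    (hLK : ∀ p ∈ K, ∃ x ∈ L, boxMap c a x = p) {δ : J → ℝ} {X : ℝ} (h : CoverLe L (δ / c) X) :
    CoverLe K δ X := by
  have := CoverLe.iUnion (I := Unit) (c := fun _ => c) (a := fun _ => a) (fun _ => hc)
    (L := fun _ => L) (fun p hp => ⟨(), hLK p hp⟩) (X := fun _ => X) (fun _ => h)
  simpa using this

/-- A packing of a shadow by intervals lifts to a packing by boxes, by attaching to each interval
a point of `K` above it. -/
lemma PackGe.of_shadow {K : Set (J → ℝ)} (hK : ∀ x ∈ K, ∀ j, 0 ≤ x j ∧ x j ≤ 1) {δ : J → ℝ}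
    (hδ : ∀ j, 0 < δ j ∧ δ j ≤ 1) (j₀ : J) {X : ℝ} (h : PackGe (shadow j₀ K) (fun _ => δ j₀) X) :
    PackGe K δ X := by
  classical
  obtain ⟨T, h1, h2, h3, h4⟩ := h
  have h2' : ∀ p : Unit → ℝ, ∃ x : J → ℝ, p ∈ T → x ∈ K ∧ p () ≤ x j₀ ∧ x j₀ ≤ p () + δ j₀ := by
    intro p
    by_cases hp : p ∈ T
    · obtain ⟨y, ⟨x, hx, hxy⟩, hy⟩ := h2 p hp
      exact ⟨x, fun _ => ⟨hx, by rw [hxy]; exact (hy ()).1, by rw [hxy]; exact (hy ()).2⟩⟩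
    · exact ⟨0, fun h => absurd h hp⟩
  choose x hx using h2'
  let g : (Unit → ℝ) → J → ℝ := fun p j => if j = j₀ then p () else min (x p j) (1 - δ j)
  have hg0 : ∀ p, g p j₀ = p () := fun p => by simp [g]
  have hg1 : ∀ p j, j ≠ j₀ → g p j = min (x p j) (1 - δ j) := fun p j hj => by simp [g, hj]
  have ginj : Function.Injective g := fun p q hpq => by
    funext u
    exact (hg0 p).symm.trans ((congrFun hpq j₀).trans (hg0 q))
  refine ⟨T.image g, ?_, ?_, ?_, ?_⟩
  · intro p hp j
    obtain ⟨q, hq, rfl⟩ := Finset.mem_image.1 hp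
    by_cases hj : j = j₀
    · subst hj
      rw [hg0]
      exact h1 q hq ()
    · rw [hg1 _ _ hj]
      have := hK _ (hx q hq).1 j
      have := hδ j
      constructor
      · exact le_min (by linarith) (by linarith)
      · linarith [min_le_right (x q j) (1 - δ j)]
  · intro p hp
    obtain ⟨q, hq, rfl⟩ := Finset.mem_image.1 hp
    refine ⟨x q, (hx q hq).1, fun j => ?_⟩
    by_cases hj : j = j₀
    · subst hj
      rw [hg0]
      exact (hx q hq).2
    · rw [hg1 _ _ hj]
      have := hK _ (hx q hq).1 j
      have := hδ j
      refine ⟨min_le_left _ _, ?_⟩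
      rcases min_choice (x q j) (1 - δ j) with e | e <;> rw [e] <;> linarith
  · intro p hp p' hp' hne
    obtain ⟨q, hq, rfl⟩ := Finset.mem_image.1 hp
    obtain ⟨q', hq', rfl⟩ := Finset.mem_image.1 hp'
    obtain ⟨u, hu⟩ := h3 q hq q' hq' (fun e => hne (by rw [e]))
    refine ⟨j₀, ?_⟩
    rw [hg0, hg0]
    exact hu
  · rwa [Finset.card_image_of_injective _ ginj]

lemma CoverLe.of_shadow {K : Set (J → ℝ)} (hK : ∀ x ∈ K, ∀ j, 0 ≤ x j ∧ x j ≤ 1) {δ : J → ℝ}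
    (j₀ : J) (hδ : ∀ j, j ≠ j₀ → 1 ≤ δ j) {X : ℝ}
    (h : CoverLe (shadow j₀ K) (fun _ => δ j₀) X) : CoverLe K δ X := by
  classical
  obtain ⟨T, h1, h2⟩ := h
  refine ⟨T.image fun p j => if j = j₀ then p () else 0, ?_, ?_⟩
  · intro x hx
    obtain ⟨p, hp, hpx⟩ := h1 (fun _ => x j₀) ⟨x, hx, rfl⟩
    refine ⟨_, Finset.mem_image_of_mem _ hp, fun j => ?_⟩
    by_cases hj : j = j₀
    · subst hj
      simpa using hpx ()
    · have := hK x hx j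
      have := hδ j hj
      simp only [hj, if_false]
      constructor <;> linarith
  · exact le_trans (Nat.cast_le.2 Finset.card_image_le) h2

lemma packGe_one {K : Set (J → ℝ)} (hne : K.Nonempty) (hK : ∀ x ∈ K, ∀ j, 0 ≤ x j ∧ x j ≤ 1)
    {δ : J → ℝ} (hδ : ∀ j, 0 < δ j ∧ δ j ≤ 1) : PackGe K δ 1 := by
  obtain ⟨x, hx⟩ := hne
  refine ⟨{fun j => min (x j) (1 - δ j)}, ?_, ?_, ?_, by simp⟩
  · intro p hp j
    rw [Finset.mem_singleton.1 hp]
    have := hK x hx j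
    have := hδ j
    constructor
    · exact le_min (by linarith) (by linarith)
    · linarith [min_le_right (x j) (1 - δ j)]
  · intro p hp
    rw [Finset.mem_singleton.1 hp]
    refine ⟨x, hx, fun j => ⟨min_le_left _ _, ?_⟩⟩
    have := hK x hx j
    have := hδ j
    show x j ≤ min (x j) (1 - δ j) + δ j
    rcases min_choice (x j) (1 - δ j) with e | e <;> rw [e] <;> linarith
  · intro p hp q hq hne
    rw [Finset.mem_singleton.1 hp, Finset.mem_singleton.1 hq] at hne
    exact absurd rfl hne

lemma coverLe_one {K : Set (J → ℝ)} (hK : ∀ x ∈ K, ∀ j, 0 ≤ x j ∧ x j ≤ 1)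
    {δ : J → ℝ} (hδ : ∀ j, 1 ≤ δ j) : CoverLe K δ 1 :=
  ⟨{fun _ => 0}, fun x hx => ⟨_, Finset.mem_singleton_self _, fun j =>
    ⟨(hK x hx j).1, by linarith [(hK x hx j).2, hδ j]⟩⟩, by simp⟩

/-- Permuting the coordinates does not change packing counts. -/
lemma PackGe.reindex (e : Equiv.Perm J) {K : Set (J → ℝ)} {δ : J → ℝ} {X : ℝ} (h : PackGe K δ X) :
    PackGe ((fun p : J → ℝ => p ∘ e) '' K) (δ ∘ e) X := by
  classical
  obtain ⟨T, h1, h2, h3, h4⟩ := h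
  have ginj : Function.Injective fun p : J → ℝ => p ∘ e := e.surjective.injective_comp_right
  refine ⟨T.image fun p => p ∘ e, ?_, ?_, ?_, ?_⟩
  · intro p hp j
    obtain ⟨q, hq, rfl⟩ := Finset.mem_image.1 hp
    exact h1 q hq (e j)
  · intro p hp
    obtain ⟨q, hq, rfl⟩ := Finset.mem_image.1 hp
    obtain ⟨x, hx, hqx⟩ := h2 q hq
    exact ⟨_, ⟨x, hx, rfl⟩, fun j => hqx (e j)⟩
  · intro p hp p' hp' hne
    obtain ⟨q, hq, rfl⟩ := Finset.mem_image.1 hp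
    obtain ⟨q', hq', rfl⟩ := Finset.mem_image.1 hp'
    obtain ⟨j, hj⟩ := h3 q hq q' hq' (fun h => hne (by rw [h]))
    exact ⟨e.symm j, by simpa using hj⟩
  · rwa [Finset.card_image_of_injective _ ginj]

end Boxes

section CoverNumber

variable {J X : Type*} [PseudoMetricSpace X]

/-- A packing bounds the covering number from below: a set of diameter at most `L δ` meets at most
`(2 L + 5) ^ |J|` boxes of the packing, since the corners of those have distinct integer parts
after division by `δ`. -/
lemma PackGe.le_coverNumber [Fintype J] {φ : X → J → ℝ} (hφ : ∀ x y j, |φ x j - φ y j| ≤ dist x y)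
    {E : Set X} {δ r : ℝ} (hδ : 0 < δ) (L : ℕ) (hr0 : 0 ≤ r) (hr : r ≤ L * δ) {Y : ℝ}
    (h : PackGe (φ '' E) (fun _ => δ) Y) :
    ENNReal.ofReal (Y / (2 * L + 5) ^ Fintype.card J) ≤ (coverNumber r E : ℝ≥0∞) := by
  classical
  obtain ⟨T, -, h2, h3, h4⟩ := h
  have h2' : ∀ p : T, ∃ x ∈ E, ∀ j, p.1 j ≤ φ x j ∧ φ x j ≤ p.1 j + δ := by
    rintro ⟨p, hp⟩
    obtain ⟨y, ⟨x, hx, rfl⟩, hy⟩ := h2 p hp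
    exact ⟨x, hx, hy⟩
  choose x hxE hx using h2'
  have key : ∀ 𝒰 : Set (Set X), (∀ U ∈ 𝒰, IsOpen U ∧ Metric.ediam U ≤ ENNReal.ofReal r) →
      E ⊆ ⋃₀ 𝒰 → ∀ n : ℕ, 𝒰.encard = n → T.card ≤ (2 * L + 5) ^ Fintype.card J * n := by
    intro 𝒰 h𝒰 hE n hn
    have hfin : 𝒰.Finite := Set.finite_of_encard_eq_coe hn
    choose U hU hxU using fun p : T => hE (hxE p)
    have hcard : hfin.toFinset.card = n := by
      rw [hfin.encard_eq_coe_toFinset_card] at hn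
      exact_mod_cast hn
    rw [← hcard, ← T.card_attach]
    refine Finset.card_le_mul_card_image_of_maps_to (f := U) (fun p _ => hfin.mem_toFinset.2 (hU p)) _
      fun V hV => ?_
    have hVd := (h𝒰 V (hfin.mem_toFinset.1 hV)).2
    rcases (T.attach.filter fun p => U p = V).eq_empty_or_nonempty with h0 | ⟨p₀, hp₀⟩
    · rw [h0]
      simp
    have hp₀V : U p₀ = V := (Finset.mem_filter.1 hp₀).2
    let B : Finset (J → ℤ) := Fintype.piFinset fun j =>
      Finset.Icc (⌊p₀.1 j / δ⌋ - (L + 2)) (⌊p₀.1 j / δ⌋ + (L + 2))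
    have hB : B.card = (2 * L + 5) ^ Fintype.card J := by
      have h : ∀ j, (Finset.Icc (⌊p₀.1 j / δ⌋ - (L + 2)) (⌊p₀.1 j / δ⌋ + (L + 2))).card
          = 2 * L + 5 := by
        intro j
        rw [Int.card_Icc]
        omega
      simp only [B, Fintype.card_piFinset, h, Finset.prod_const, Finset.card_univ]
    rw [← hB]
    refine Finset.card_le_card_of_injOn (fun p j => ⌊p.1 j / δ⌋) ?_ ?_
    · intro p hp
      have hpV : U p = V := (Finset.mem_filter.1 hp).2
      have hd : dist (x p) (x p₀) ≤ r := by
        have h1 : edist (x p) (x p₀) ≤ ENNReal.ofReal r :=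
          (Metric.edist_le_ediam_of_mem (hpV ▸ hxU p) (hp₀V ▸ hxU p₀)).trans hVd
        rw [edist_dist] at h1
        exact (ENNReal.ofReal_le_ofReal_iff hr0).1 h1
      refine Fintype.mem_piFinset.2 fun j => ?_
      have h1 := abs_le.1 ((hφ (x p) (x p₀) j).trans hd)
      have h2 := hx p j
      have h3 := hx p₀ j
      have h5 : p.1 j / δ ≤ p₀.1 j / δ + (L + 1) := by
        rw [div_add' _ _ _ hδ.ne']
        gcongr
        linarith
      have h6 : p₀.1 j / δ ≤ p.1 j / δ + (L + 1) := by
        rw [div_add' _ _ _ hδ.ne']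
        gcongr
        linarith
      have e1 := Int.floor_le (p.1 j / δ)
      have e2 := Int.lt_floor_add_one (p.1 j / δ)
      have e3 := Int.floor_le (p₀.1 j / δ)
      have e4 := Int.lt_floor_add_one (p₀.1 j / δ)
      have f1 : (⌊p.1 j / δ⌋ : ℝ) < ((⌊p₀.1 j / δ⌋ + (L + 2) : ℤ) : ℝ) := by
        push_cast
        linarith
      have f2 : ((⌊p₀.1 j / δ⌋ - (L + 2) : ℤ) : ℝ) < (⌊p.1 j / δ⌋ : ℝ) := by
        push_cast
        linarith
      exact Finset.mem_Icc.2 ⟨(Int.cast_lt.1 f2).le, (Int.cast_lt.1 f1).le⟩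
    · intro p _ q _ hpq
      by_contra hne
      obtain ⟨j, hj⟩ := h3 p.1 p.2 q.1 q.2 (fun h => hne (Subtype.ext h))
      have := Int.abs_sub_lt_one_of_floor_eq_floor (congrFun hpq j)
      rw [← sub_div, abs_div, abs_of_pos hδ, div_lt_one hδ] at this
      exact absurd hj (not_le.2 this)
  have hN : (0 : ℝ) < (2 * L + 5) ^ Fintype.card J := by positivity
  have hceil : ((⌈Y / (2 * L + 5) ^ Fintype.card J⌉₊ : ℕ) : ℕ∞) ≤ coverNumber r E := by
    refine le_iInf fun 𝒰 => le_iInf fun h𝒰 => le_iInf fun hE => ?_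
    induction h : 𝒰.encard using ENat.recTopCoe with
    | top => exact le_top
    | coe n =>
      refine Nat.cast_le.2 (Nat.ceil_le.2 ?_)
      rw [div_le_iff₀' hN]
      exact h4.trans (by exact_mod_cast key 𝒰 h𝒰 hE n h)
  calc ENNReal.ofReal (Y / (2 * L + 5) ^ Fintype.card J)
      ≤ ENNReal.ofReal (⌈Y / (2 * L + 5) ^ Fintype.card J⌉₊ : ℝ) :=
        ENNReal.ofReal_le_ofReal (Nat.le_ceil _)
    _ = (((⌈Y / (2 * L + 5) ^ Fintype.card J⌉₊ : ℕ) : ℕ∞) : ℝ≥0∞) := by simp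
    _ ≤ _ := ENat.toENNReal_le.2 hceil

/-- A cover by boxes bounds the covering number from above: each box that meets `E` is replaced by
the open ball of radius `r / 2` about one of its points. -/
lemma CoverLe.coverNumber_le {φ : X → J → ℝ} {E : Set X} {δ r : ℝ}
    (hφ : ∀ x ∈ E, ∀ y ∈ E, (∀ j, |φ x j - φ y j| ≤ δ) → dist x y < r / 2) {Y : ℝ}
    (h : CoverLe (φ '' E) (fun _ => δ) Y) :
    (coverNumber r E : ℝ≥0∞) ≤ ENNReal.ofReal Y := by
  classical
  obtain ⟨T, h1, h2⟩ := h
  let A : (J → ℝ) → Set X := fun p => {x ∈ E | ∀ j, p j ≤ φ x j ∧ φ x j ≤ p j + δ}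
  let B : (J → ℝ) → Set X := fun p => ⋃ (h : (A p).Nonempty), Metric.ball h.some (r / 2)
  have hle : coverNumber r E ≤ (T.card : ℕ∞) := by
    refine iInf_le_of_le (T.image B : Set (Set X)) (iInf_le_of_le ?_ (iInf_le_of_le ?_ ?_))
    · intro U hU
      obtain ⟨p, -, rfl⟩ := Finset.mem_image.1 (Finset.mem_coe.1 hU)
      refine ⟨isOpen_iUnion fun _ => Metric.isOpen_ball, ?_⟩
      by_cases hA : (A p).Nonempty
      · simp only [B, hA, Set.iUnion_true]
        refine Metric.ediam_le fun x hx y hy => ?_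
        rw [edist_dist]
        refine ENNReal.ofReal_le_ofReal ?_
        have := dist_triangle_right x y hA.some
        rw [Metric.mem_ball] at hx hy
        linarith
      · simp only [B, hA, Set.iUnion_false, Metric.ediam_empty, zero_le]
    · intro x hx
      obtain ⟨p, hp, hpx⟩ := h1 (φ x) ⟨x, hx, rfl⟩
      have hxA : x ∈ A p := ⟨hx, hpx⟩
      have hA : (A p).Nonempty := ⟨x, hxA⟩
      refine ⟨B p, by simpa using ⟨p, hp, rfl⟩, Set.mem_iUnion.2 ⟨hA, ?_⟩⟩
      refine hφ x hx _ hA.some_mem.1 fun j => abs_le.2 ?_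
      have := hpx j
      have := hA.some_mem.2 j
      constructor <;> linarith
    · rw [Set.encard_coe_eq_coe_finsetCard]
      exact_mod_cast Finset.card_image_le
  calc (coverNumber r E : ℝ≥0∞) ≤ ((T.card : ℕ∞) : ℝ≥0∞) := ENat.toENNReal_le.2 hle
    _ = ENNReal.ofReal (T.card : ℝ) := by simp
    _ ≤ _ := ENNReal.ofReal_le_ofReal h2

end CoverNumber

/-! ### Self-similar sets on the line -/

section SelfSimilar

lemma exists_sum_rpow_eq_one {I : Type*} [Fintype I] [Nonempty I] {c : I → ℝ}
    (hc : ∀ i, 0 < c i ∧ c i < 1) : ∃ s : ℝ, 0 ≤ s ∧ ∑ i, c i ^ s = 1 := by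
  have hlim : Tendsto (fun s : ℝ => ∑ i, c i ^ s) atTop (𝓝 0) := by
    have := tendsto_finsetSum (Finset.univ : Finset I) fun i _ =>
      tendsto_rpow_atTop_of_base_lt_one (c i) (by linarith [(hc i).1]) (hc i).2
    simpa using this
  obtain ⟨N, hN1, hN0⟩ := ((hlim.eventually_le_const one_pos).and (eventually_ge_atTop 0)).exists
  have hcont : ContinuousOn (fun s : ℝ => ∑ i, c i ^ s) (Set.Icc 0 N) := by
    refine Continuous.continuousOn (continuous_finsetSum _ fun i _ => ?_)
    exact Real.continuous_const_rpow (hc i).1.ne'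
  have h0 : (1 : ℝ) ≤ ∑ i, c i ^ (0 : ℝ) := by
    simp only [Real.rpow_zero, Finset.sum_const, Finset.card_univ, nsmul_eq_mul, mul_one]
    exact_mod_cast Fintype.card_pos
  obtain ⟨s, hs, hs1⟩ := intermediate_value_Icc' hN0 hcont ⟨hN1, h0⟩
  exact ⟨s, hs.1, hs1⟩

lemma div_rpow_neg {x c : ℝ} (hx : 0 < x) (hc : 0 < c) (s : ℝ) :
    (x / c) ^ (-s) = x ^ (-s) * c ^ s := by
  rw [Real.div_rpow hx.le hc.le, Real.rpow_neg hc.le, div_inv_eq_mul]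

variable {I : Type*} [Fintype I] {c a : I → ℝ} {lo hi s : ℝ} {K : Set (Unit → ℝ)}

/-- Lower counting bound for a self-similar set on the line; only `⋃ f_i(K) ⊆ K` and
`∑ c_i ^ s ≥ 1` are needed. -/
lemma packGe_selfSimilar (hlo : 0 < lo) (hhi : hi < 1) (hc : ∀ i, lo ≤ c i ∧ c i ≤ hi)
    (ha : ∀ i, 0 ≤ a i) (hac : ∀ i, a i + c i ≤ 1)
    (hsep : ∀ i i', i ≠ i' → a i + c i ≤ a i' ∨ a i' + c i' ≤ a i)
    (hs : 0 ≤ s) (hsum : 1 ≤ ∑ i, c i ^ s) (hne : K.Nonempty)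
    (hK : ∀ x ∈ K, ∀ j, 0 ≤ x j ∧ x j ≤ 1)
    (hmap : ∀ i, ∀ x ∈ K, boxMap (fun _ => c i) (fun _ => a i) x ∈ K) {δ : ℝ} (hδ : 0 < δ)
    (hδ1 : δ ≤ 1) : PackGe K (fun _ => δ) (lo ^ s * δ ^ (-s)) := by
  have key : ∀ n : ℕ, ∀ δ : ℝ, 0 < δ → δ ≤ 1 → hi ^ n ≤ δ →
      PackGe K (fun _ => δ) (lo ^ s * δ ^ (-s)) := by
    intro n
    induction n with
    | zero =>
      intro δ h0 h1 h2
      have : δ = 1 := le_antisymm h1 (by simpa using h2)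
      subst this
      refine (packGe_one hne hK (by simp)).mono le_rfl ?_
      rw [Real.one_rpow, mul_one]
      obtain ⟨i⟩ : Nonempty I := by
        by_contra h
        rw [not_nonempty_iff] at h
        rw [Finset.univ_eq_empty, Finset.sum_empty] at hsum
        linarith
      exact Real.rpow_le_one hlo.le (by linarith [(hc i).1, (hc i).2]) hs
    | succ n ih =>
      intro δ h0 h1 h2
      rcases lt_or_ge lo δ with h | h
      · refine (packGe_one hne hK (fun _ => ⟨h0, h1⟩)).mono le_rfl ?_
        rw [Real.rpow_neg h0.le, ← div_eq_mul_inv, div_le_one (by positivity)]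
        exact Real.rpow_le_rpow hlo.le h.le hs
      · have hstep : ∀ i, PackGe K ((fun _ => δ) / (fun _ => c i)) (lo ^ s * (δ / c i) ^ (-s)) := by
          intro i
          have hci : 0 < c i := hlo.trans_le (hc i).1
          refine ih (δ / c i) (by positivity) ?_ ?_
          · exact (div_le_one hci).2 (h.trans (hc i).1)
          · rw [le_div_iff₀ hci]
            refine le_trans ?_ h2
            rw [pow_succ]
            exact mul_le_mul_of_nonneg_left (hc i).2 (pow_nonneg (hci.le.trans (hc i).2) _)
        have := PackGe.iUnion (c := fun i _ => c i) (a := fun i _ => a i)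
          (fun i _ => hlo.trans_le (hc i).1) (fun i _ => ha i) (fun i _ => hac i)
          (fun i i' h => ⟨(), hsep i i' h⟩) (K := K) (L := fun _ => K) hmap (δ := fun _ => δ)
          (fun _ => h0) hstep
        refine this.mono le_rfl ?_
        have e : ∀ i, lo ^ s * (δ / c i) ^ (-s) = lo ^ s * δ ^ (-s) * c i ^ s := fun i => by
          rw [div_rpow_neg h0 (hlo.trans_le (hc i).1), mul_assoc]
        simp only [e, ← Finset.mul_sum]
        exact le_mul_of_one_le_right (by positivity) hsum
  obtain ⟨n, hn⟩ := exists_pow_lt_of_lt_one hδ hhi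
  exact key n δ hδ hδ1 hn.le

/-- Upper counting bound for a self-similar set on the line; only `K ⊆ ⋃ f_i(K)` and
`∑ c_i ^ s ≤ 1` are needed. -/
lemma coverLe_selfSimilar (hlo : 0 < lo) (hhi : hi < 1) (hc : ∀ i, lo ≤ c i ∧ c i ≤ hi)
    (hs : 0 ≤ s) (hsum : ∑ i, c i ^ s ≤ 1) (hK : ∀ x ∈ K, ∀ j, 0 ≤ x j ∧ x j ≤ 1)
    (hmap : ∀ p ∈ K, ∃ i, ∃ x ∈ K, boxMap (fun _ => c i) (fun _ => a i) x = p) {δ : ℝ}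
    (hδ : 0 < δ) (hδ1 : δ ≤ 1 / lo) : CoverLe K (fun _ => δ) (lo ^ (-s) * δ ^ (-s)) := by
  have key : ∀ n : ℕ, ∀ δ : ℝ, 0 < δ → δ ≤ 1 / lo → hi ^ n ≤ δ →
      CoverLe K (fun _ => δ) (lo ^ (-s) * δ ^ (-s)) := by
    have hbase : ∀ δ : ℝ, 1 ≤ δ → δ ≤ 1 / lo → CoverLe K (fun _ => δ) (lo ^ (-s) * δ ^ (-s)) := by
      intro δ h1 h2
      refine (coverLe_one hK fun _ => h1).mono le_rfl ?_
      have h0 : 0 < δ := by linarith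
      rw [← Real.mul_rpow hlo.le h0.le]
      refine Real.one_le_rpow_of_pos_of_le_one_of_nonpos (by positivity) ?_ (by linarith)
      rwa [le_div_iff₀' hlo] at h2
    intro n
    induction n with
    | zero => exact fun δ _ h1 h2 => hbase δ (by simpa using h2) h1
    | succ n ih =>
      intro δ h0 h1 h2
      rcases le_or_gt 1 δ with h | h
      · exact hbase δ h h1
      · have hstep : ∀ i, CoverLe K ((fun _ => δ) / (fun _ => c i))
            (lo ^ (-s) * (δ / c i) ^ (-s)) := by
          intro i
          have hci : 0 < c i := hlo.trans_le (hc i).1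
          refine ih (δ / c i) (by positivity) (div_le_div₀ zero_le_one h.le hlo (hc i).1) ?_
          rw [le_div_iff₀ hci]
          refine le_trans ?_ h2
          rw [pow_succ]
          exact mul_le_mul_of_nonneg_left (hc i).2 (pow_nonneg (hci.le.trans (hc i).2) _)
        have := CoverLe.iUnion (c := fun i _ => c i) (a := fun i _ => a i)
          (fun i _ => hlo.trans_le (hc i).1) (K := K) (L := fun _ => K) hmap (δ := fun _ => δ) hstep
        refine this.mono le_rfl ?_
        have e : ∀ i, lo ^ (-s) * (δ / c i) ^ (-s) = lo ^ (-s) * δ ^ (-s) * c i ^ s := fun i => by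
          rw [div_rpow_neg h0 (hlo.trans_le (hc i).1), mul_assoc]
        simp only [e, ← Finset.mul_sum]
        exact mul_le_of_le_one_right (by positivity) hsum
  obtain ⟨n, hn⟩ := exists_pow_lt_of_lt_one hδ hhi
  exact key n δ hδ hδ1 hn.le

end SelfSimilar

section BoxDimension

variable {X : Type*} [PseudoMetricSpace X] {E : Set X} {s A B : ℝ}

lemma hasBoxDim_of_bounds (hA : 0 < A) (hB : 0 < B)
    (hl : ∀ r, 0 < r → r < 1 → ENNReal.ofReal (A * r ^ (-s)) ≤ (coverNumber r E : ℝ≥0∞))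
    (hu : ∀ r, 0 < r → r < 1 → (coverNumber r E : ℝ≥0∞) ≤ ENNReal.ofReal (B * r ^ (-s))) :
    HasBoxDim E s := by
  have hlim : ∀ A : ℝ, Tendsto
      (fun r : ℝ => (((Real.log A - s * Real.log r) / (-Real.log r) : ℝ) : EReal)) (𝓝[>] 0)
      (𝓝 (s : EReal)) := by
    intro A
    refine (continuous_coe_real_ereal.tendsto s).comp ?_
    have h1 : Tendsto (fun r : ℝ => -Real.log r) (𝓝[>] 0) atTop :=
      tendsto_neg_atBot_atTop.comp Real.tendsto_log_nhdsGT_zero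
    have h2 := (h1.const_div_atTop (Real.log A)).add_const s
    rw [zero_add] at h2
    refine h2.congr' ?_
    filter_upwards [h1.eventually_gt_atTop 0] with r hr
    have : Real.log r ≠ 0 := by linarith
    field_simp
    ring
  have hev : ∀ᶠ r : ℝ in 𝓝[>] 0, 0 < r ∧ r < 1 := Ioo_mem_nhdsGT one_pos
  have hlog : ∀ A r : ℝ, 0 < A → 0 < r → ENNReal.log (ENNReal.ofReal (A * r ^ (-s)))
      = ((Real.log A - s * Real.log r : ℝ) : EReal) := by
    intro A r hA hr
    rw [ENNReal.log_ofReal_of_pos (by positivity), Real.log_mul hA.ne' (by positivity),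
      Real.log_rpow hr]
    congr 1
    ring
  have key : Tendsto (boxRatio E) (𝓝[>] 0) (𝓝 (s : EReal)) := by
    refine tendsto_of_tendsto_of_tendsto_of_le_of_le' (hlim A) (hlim B) ?_ ?_
    · filter_upwards [hev] with r hr
      rw [EReal.coe_div, ← hlog A r hA hr.1]
      refine EReal.div_le_div_right_of_nonneg ?_ (ENNReal.log_monotone (hl r hr.1 hr.2))
      exact_mod_cast neg_nonneg.2 (Real.log_nonpos hr.1.le hr.2.le)
    · filter_upwards [hev] with r hr
      rw [EReal.coe_div, ← hlog B r hB hr.1]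
      refine EReal.div_le_div_right_of_nonneg ?_ (ENNReal.log_monotone (hu r hr.1 hr.2))
      exact_mod_cast neg_nonneg.2 (Real.log_nonpos hr.1.le hr.2.le)
  exact ⟨key.liminf_eq, key.limsup_eq⟩

end BoxDimension

/-! ### Column carpets and lower counting bounds -/

/-- A self-affine set `K` in the unit square that is organised in columns: the `i`-th map has
ratios `c i` and translation `a i`; its image of the square has base equal to the interval
`[left k, left k + width k]`, where `k = col i`; distinct columns do not overlap, and neither do
distinct rectangles of one column. The numbers `lo` and `hi` are uniform bounds for all ratios.
Both classes of carpets, and with coordinates interchanged both directions of a Barański carpet,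
are of this form. -/
structure ColumnCarpet (ι κ : Type*) where
  c : ι → Fin 2 → ℝ
  a : ι → Fin 2 → ℝ
  col : ι → κ
  width : κ → ℝ
  left : κ → ℝ
  lo : ℝ
  hi : ℝ
  K : Set (Fin 2 → ℝ)
  col_surj : Function.Surjective col
  c_zero : ∀ i, c i 0 = width (col i)
  a_zero : ∀ i, a i 0 = left (col i)
  lo_pos : 0 < lo
  lo_le : ∀ i l, lo ≤ c i l
  le_hi : ∀ i l, c i l ≤ hi
  hi_lt : hi < 1
  a_nonneg : ∀ i l, 0 ≤ a i l
  add_le : ∀ i l, a i l + c i l ≤ 1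
  sep_col : ∀ k k', k ≠ k' → left k + width k ≤ left k' ∨ left k' + width k' ≤ left k
  sep_row : ∀ i i', i ≠ i' → col i = col i' →
    a i 1 + c i 1 ≤ a i' 1 ∨ a i' 1 + c i' 1 ≤ a i 1
  K_ne : K.Nonempty
  K_cube : ∀ x ∈ K, ∀ l, 0 ≤ x l ∧ x l ≤ 1
  K_eq : K = ⋃ i, boxMap (c i) (a i) '' K

namespace ColumnCarpet

variable {ι κ : Type*} (S : ColumnCarpet ι κ)

lemma c_pos (i : ι) (l : Fin 2) : 0 < S.c i l := S.lo_pos.trans_le (S.lo_le i l)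

lemma lo_le_width (k : κ) : S.lo ≤ S.width k := by
  obtain ⟨i, rfl⟩ := S.col_surj k
  exact S.c_zero i ▸ S.lo_le i 0

lemma width_le_hi (k : κ) : S.width k ≤ S.hi := by
  obtain ⟨i, rfl⟩ := S.col_surj k
  exact S.c_zero i ▸ S.le_hi i 0

lemma left_nonneg (k : κ) : 0 ≤ S.left k := by
  obtain ⟨i, rfl⟩ := S.col_surj k
  exact S.a_zero i ▸ S.a_nonneg i 0

lemma left_add_width_le (k : κ) : S.left k + S.width k ≤ 1 := by
  obtain ⟨i, rfl⟩ := S.col_surj k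
  exact S.a_zero i ▸ S.c_zero i ▸ S.add_le i 0

lemma width_pos (k : κ) : 0 < S.width k := S.lo_pos.trans_le (S.lo_le_width k)

lemma hi_pos (i : ι) : 0 < S.hi := (S.c_pos i 0).trans_le (S.le_hi i 0)

lemma lo_lt_one : S.lo < 1 := by
  obtain ⟨x, hx⟩ := S.K_ne
  rw [S.K_eq] at hx
  obtain ⟨i, -⟩ := Set.mem_iUnion.1 hx
  exact ((S.lo_le i 0).trans (S.le_hi i 0)).trans_lt S.hi_lt

lemma map_mem (i : ι) {x : Fin 2 → ℝ} (hx : x ∈ S.K) : boxMap (S.c i) (S.a i) x ∈ S.K := by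
  rw [S.K_eq]
  exact Set.mem_iUnion.2 ⟨i, x, hx, rfl⟩

lemma exists_preimage {x : Fin 2 → ℝ} (hx : x ∈ S.K) :
    ∃ i, ∃ y ∈ S.K, boxMap (S.c i) (S.a i) y = x := by
  rw [S.K_eq] at hx
  obtain ⟨i, y, hy, e⟩ := Set.mem_iUnion.1 hx
  exact ⟨i, y, hy, e⟩

lemma sep {i i' : ι} (h : i ≠ i') :
    ∃ l, S.a i l + S.c i l ≤ S.a i' l ∨ S.a i' l + S.c i' l ≤ S.a i l := by
  by_cases hc : S.col i = S.col i'
  · exact ⟨1, S.sep_row i i' h hc⟩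
  · refine ⟨0, ?_⟩
    rw [S.a_zero, S.a_zero, S.c_zero, S.c_zero]
    exact S.sep_col _ _ hc

lemma shadow_cube {L : Set (Fin 2 → ℝ)} (hL : L ⊆ S.K) (l : Fin 2) :
    ∀ x ∈ shadow l L, ∀ j, 0 ≤ x j ∧ x j ≤ 1 := by
  rintro x ⟨y, hy, e⟩ j
  exact e ▸ S.K_cube y (hL hy) l

/-- A power of an upper bound for the ratios below `δ` gives the termination measure for
recursions that replace `δ` by `δ / c`. -/
lemma pow_le_div {n : ℕ} {δ : ℝ} (i : ι) (l : Fin 2) (h : S.hi ^ (n + 1) ≤ δ) :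
    S.hi ^ n ≤ δ / S.c i l := by
  rw [le_div_iff₀ (S.c_pos i l)]
  refine le_trans ?_ h
  rw [pow_succ]
  exact mul_le_mul_of_nonneg_left (S.le_hi i l) (pow_nonneg (S.hi_pos i).le _)

section Lower

variable {s t : ℝ}

lemma packGe_shadow_zero [Fintype κ] (hs : 0 ≤ s) (hsum : 1 ≤ ∑ k, S.width k ^ s) {δ : ℝ}
    (hδ : 0 < δ) (hδ1 : δ ≤ 1) : PackGe (shadow 0 S.K) (fun _ => δ) (S.lo ^ s * δ ^ (-s)) := by
  refine packGe_selfSimilar (c := S.width) (a := S.left) S.lo_pos S.hi_lt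
    (fun k => ⟨S.lo_le_width k, S.width_le_hi k⟩) S.left_nonneg S.left_add_width_le S.sep_col hs hsum
    ?_ (S.shadow_cube le_rfl 0) ?_ hδ hδ1
  · obtain ⟨x, hx⟩ := S.K_ne
    exact ⟨fun _ => x 0, x, hx, rfl⟩
  · rintro k x ⟨y, hy, e⟩
    obtain ⟨i, rfl⟩ := S.col_surj k
    exact ⟨_, S.map_mem i hy, by simp [boxMap, S.c_zero, S.a_zero, e]⟩

lemma packGe_shadow_one [Fintype ι] [DecidableEq κ] (ht : 0 ≤ t) (k : κ) (hsum : 1 ≤ ∑ i : {i // S.col i = k}, S.c i 1 ^ t)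
    {δ : ℝ} (hδ : 0 < δ) (hδ1 : δ ≤ 1) :
    PackGe (shadow 1 S.K) (fun _ => δ) (S.lo ^ t * δ ^ (-t)) := by
  refine packGe_selfSimilar (I := {i // S.col i = k}) (c := fun i => S.c i 1) (a := fun i => S.a i 1)
    S.lo_pos S.hi_lt
    (fun i => ⟨S.lo_le i 1, S.le_hi i 1⟩) (fun i => S.a_nonneg i 1) (fun i => S.add_le i 1)
    (fun i i' h => S.sep_row i i' (fun e => h (Subtype.ext e)) (i.2.trans i'.2.symm)) ht hsum
    ?_ (S.shadow_cube le_rfl 1) ?_ hδ hδ1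
  · obtain ⟨x, hx⟩ := S.K_ne
    exact ⟨fun _ => x 1, x, hx, rfl⟩
  · rintro i x ⟨y, hy, e⟩
    exact ⟨_, S.map_mem i hy, by simp [boxMap, e]⟩

/-- The part of `K` in the vertical strip of half-width `α` about `x`. -/
def vstrip (x : Fin 2 → ℝ) (α : ℝ) : Set (Fin 2 → ℝ) := {p ∈ S.K | |p 0 - x 0| ≤ α}

lemma map_mem_vstrip {i i' : ι} (h : S.col i' = S.col i) {x p : Fin 2 → ℝ} {α : ℝ}
    (hp : p ∈ S.vstrip x (α / S.c i 0)) :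
    boxMap (S.c i') (S.a i') p ∈ S.vstrip (boxMap (S.c i) (S.a i) x) α := by
  refine ⟨S.map_mem i' hp.1, ?_⟩
  have := hp.2
  have hc := S.c_pos i 0
  rw [le_div_iff₀' hc] at this
  simp only [boxMap, S.c_zero, S.a_zero, h] at *
  rw [show S.width (S.col i) * p 0 + S.left (S.col i) - (S.width (S.col i) * x 0 + S.left (S.col i))
    = S.width (S.col i) * (p 0 - x 0) by ring, abs_mul, abs_of_pos hc]
  exact this

lemma vstrip_eq {x : Fin 2 → ℝ} (hx : x ∈ S.K) {α : ℝ} (hα : 1 ≤ α) : S.vstrip x α = S.K := by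
  ext p
  refine ⟨fun h => h.1, fun h => ⟨h, abs_le.2 ?_⟩⟩
  have h1 := S.K_cube x hx 0
  have h2 := S.K_cube p h 0
  constructor <;> linarith

lemma packGe_shadow_vstrip [Fintype κ] (hs : 0 ≤ s) (hsum : 1 ≤ ∑ k, S.width k ^ s)
    {x : Fin 2 → ℝ} (hx : x ∈ S.K) {α δ : ℝ} (hα : 0 < α) (hα1 : α ≤ 1 / S.lo) (hδ : 0 < δ)
    (hδα : δ ≤ S.lo * α) :
    PackGe (shadow 0 (S.vstrip x α)) (fun _ => δ) (S.lo ^ s * S.lo ^ s * (α ^ s * δ ^ (-s))) := by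
  have hlo := S.lo_pos
  have key : ∀ n : ℕ, ∀ x ∈ S.K, ∀ α δ : ℝ, 0 < α → α ≤ 1 / S.lo → 0 < δ → δ ≤ S.lo * α →
      S.hi ^ n ≤ α →
      PackGe (shadow 0 (S.vstrip x α)) (fun _ => δ) (S.lo ^ s * S.lo ^ s * (α ^ s * δ ^ (-s))) := by
    have hbase : ∀ x ∈ S.K, ∀ α δ : ℝ, 1 ≤ α → α ≤ 1 / S.lo → 0 < δ → δ ≤ S.lo * α →
        PackGe (shadow 0 (S.vstrip x α)) (fun _ => δ)
          (S.lo ^ s * S.lo ^ s * (α ^ s * δ ^ (-s))) := by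
      intro x hx α δ h1 h2 h3 h4
      rw [S.vstrip_eq hx h1]
      have h2' : S.lo * α ≤ 1 := by rwa [le_div_iff₀' hlo] at h2
      refine (S.packGe_shadow_zero hs hsum h3 (h4.trans h2')).mono le_rfl ?_
      have : S.lo ^ s * α ^ s ≤ 1 := by
        rw [← Real.mul_rpow hlo.le (by linarith)]
        exact Real.rpow_le_one (by positivity) h2' hs
      calc S.lo ^ s * S.lo ^ s * (α ^ s * δ ^ (-s))
          = (S.lo ^ s * δ ^ (-s)) * (S.lo ^ s * α ^ s) := by ring
        _ ≤ _ := mul_le_of_le_one_right (by positivity) this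
    intro n
    induction n with
    | zero => exact fun x hx α δ _ h1 h2 h3 h4 => hbase x hx α δ (by simpa using h4) h1 h2 h3
    | succ n ih =>
      intro x hx α δ h0 h1 h2 h3 h4
      rcases le_or_gt 1 α with h | h
      · exact hbase x hx α δ h h1 h2 h3
      obtain ⟨i, y, hy, rfl⟩ := S.exists_preimage hx
      have hc := S.c_pos i 0
      have := ih y hy (α / S.c i 0) (δ / S.c i 0) (by positivity)
        (div_le_div₀ zero_le_one h.le hlo (S.lo_le i 0)) (by positivity)
        (by rw [← mul_div_assoc]; gcongr) (S.pow_le_div i 0 h4)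
      rw [div_rpow_neg h2 hc, Real.div_rpow h0.le hc.le] at this
      refine PackGe.image (c := fun _ => S.c i 0) (a := fun _ => S.a i 0) (fun _ => hc)
        (fun _ => S.a_nonneg i 0) (fun _ => S.add_le i 0) ?_ (fun _ => h2) (this.mono le_rfl ?_)
      · rintro z ⟨w, hw, e⟩
        exact ⟨_, S.map_mem_vstrip rfl hw, by simp [boxMap, e]⟩
      · refine le_of_eq ?_
        have : S.c i 0 ^ s ≠ 0 := by positivity
        field_simp
  obtain ⟨n, hn⟩ := exists_pow_lt_of_lt_one hα S.hi_lt
  exact key n x hx α δ hα hα1 hδ hδα hn.le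

lemma sum_fiber_ge [Fintype ι] [Fintype κ] [DecidableEq κ] (hsum : 1 ≤ ∑ k, S.width k ^ s)
    (htsum : ∀ k, 1 ≤ ∑ i : {i // S.col i = k}, S.c i 1 ^ t) :
    1 ≤ ∑ i, S.c i 0 ^ s * S.c i 1 ^ t := by
  rw [← Fintype.sum_fiberwise S.col]
  refine hsum.trans (Finset.sum_le_sum fun k _ => ?_)
  have : ∀ i : {i // S.col i = k}, S.c i 0 ^ s * S.c i 1 ^ t = S.width k ^ s * S.c i 1 ^ t :=
    fun i => by rw [S.c_zero, i.2]
  simp only [this, ← Finset.mul_sum]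
  have := S.width_pos k
  exact le_mul_of_one_le_right (by positivity) (htsum k)

/-- Lower counting bound for boxes `δ₀ × δ₁` in the whole of `K`. If one of `δ₀`, `δ₁` exceeds the
smallest ratio, the shadow in the other direction suffices; otherwise all maps are used, and
`∑ c_i ^ s * d_i ^ t ≥ 1`. -/
lemma packGe_whole [Fintype ι] [Fintype κ] [DecidableEq κ] (hs : 0 ≤ s) (ht : 0 ≤ t) (hsum : 1 ≤ ∑ k, S.width k ^ s)
    (htsum : ∀ k, 1 ≤ ∑ i : {i // S.col i = k}, S.c i 1 ^ t) {δ : Fin 2 → ℝ}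
    (hδ : ∀ l, 0 < δ l ∧ δ l ≤ 1) :
    PackGe S.K δ (S.lo ^ s * S.lo ^ t * (δ 0 ^ (-s) * δ 1 ^ (-t))) := by
  have hlo := S.lo_pos
  have hsmall : ∀ δ u : ℝ, 0 ≤ u → S.lo ≤ δ → S.lo ^ u * δ ^ (-u) ≤ 1 := by
    intro δ u hu h
    have : 0 < δ := hlo.trans_le h
    rw [Real.rpow_neg this.le, ← div_eq_mul_inv, div_le_one (by positivity)]
    exact Real.rpow_le_rpow hlo.le h hu
  have key : ∀ n : ℕ, ∀ δ : Fin 2 → ℝ, (∀ l, 0 < δ l ∧ δ l ≤ 1) → S.hi ^ n ≤ δ 1 →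
      PackGe S.K δ (S.lo ^ s * S.lo ^ t * (δ 0 ^ (-s) * δ 1 ^ (-t))) := by
    have hbase : ∀ δ : Fin 2 → ℝ, (∀ l, 0 < δ l ∧ δ l ≤ 1) → S.lo ≤ δ 1 →
        PackGe S.K δ (S.lo ^ s * S.lo ^ t * (δ 0 ^ (-s) * δ 1 ^ (-t))) := by
      intro δ h0 h1
      refine (PackGe.of_shadow S.K_cube h0 0
        (S.packGe_shadow_zero hs hsum (h0 0).1 (h0 0).2)).mono le_rfl ?_
      have := (h0 0).1
      calc _ = (S.lo ^ s * δ 0 ^ (-s)) * (S.lo ^ t * δ 1 ^ (-t)) := by ring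
        _ ≤ _ := mul_le_of_le_one_right (by positivity) (hsmall _ _ ht h1)
    intro n
    induction n with
    | zero => exact fun δ h0 h1 => hbase δ h0 (S.lo_lt_one.le.trans (by simpa using h1))
    | succ n ih =>
      intro δ h0 h1
      have p0 := (h0 0).1
      have p1 := (h0 1).1
      rcases le_or_gt S.lo (δ 1) with h | h
      · exact hbase δ h0 h
      rcases le_or_gt S.lo (δ 0) with h' | h'
      · obtain ⟨x, hx⟩ := S.K_ne
        obtain ⟨i, -⟩ := S.exists_preimage hx
        refine (PackGe.of_shadow S.K_cube h0 1
          (S.packGe_shadow_one ht (S.col i) (htsum _) (h0 1).1 (h0 1).2)).mono le_rfl ?_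
        calc _ = (S.lo ^ t * δ 1 ^ (-t)) * (S.lo ^ s * δ 0 ^ (-s)) := by ring
          _ ≤ _ := mul_le_of_le_one_right (by positivity) (hsmall _ _ hs h')
      have hstep : ∀ i, PackGe S.K (δ / S.c i) (S.lo ^ s * S.lo ^ t *
          ((δ / S.c i) 0 ^ (-s) * (δ / S.c i) 1 ^ (-t))) := by
        intro i
        refine ih _ (fun l => ?_) (S.pow_le_div i 1 h1)
        have hc := S.c_pos i l
        refine ⟨div_pos (h0 l).1 hc, (div_le_one hc).2 (le_trans ?_ (S.lo_le i l))⟩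
        fin_cases l
        · exact h'.le
        · exact h.le
      refine (PackGe.iUnion S.c_pos S.a_nonneg S.add_le (fun i i' h => S.sep h) (K := S.K)
        (L := fun _ => S.K) (fun i x hx => S.map_mem i hx) (fun l => (h0 l).1) hstep).mono le_rfl ?_
      have e : ∀ i, S.lo ^ s * S.lo ^ t * ((δ / S.c i) 0 ^ (-s) * (δ / S.c i) 1 ^ (-t)) =
          S.lo ^ s * S.lo ^ t * (δ 0 ^ (-s) * δ 1 ^ (-t)) * (S.c i 0 ^ s * S.c i 1 ^ t) := by
        intro i
        simp only [Pi.div_apply]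
        rw [div_rpow_neg p0 (S.c_pos i 0), div_rpow_neg p1 (S.c_pos i 1)]
        ring
      simp only [e, ← Finset.mul_sum]
      exact le_mul_of_one_le_right (by positivity) (S.sum_fiber_ge hsum htsum)
  obtain ⟨n, hn⟩ := exists_pow_lt_of_lt_one (hδ 1).1 S.hi_lt
  exact key n δ hδ hn.le

/-- Lower counting bound for boxes in a vertical strip centred at a point of `K`: as long as the
strip is narrower than the square, only the maps of the column that contains the centre are
used. -/
lemma packGe_vstrip [Fintype ι] [Fintype κ] [DecidableEq κ] (hs : 0 ≤ s) (ht : 0 ≤ t) (hsum : 1 ≤ ∑ k, S.width k ^ s)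
    (htsum : ∀ k, 1 ≤ ∑ i : {i // S.col i = k}, S.c i 1 ^ t) {x : Fin 2 → ℝ} (hx : x ∈ S.K)
    {α : ℝ} (hα : 0 < α) (hα1 : α ≤ 1 / S.lo) {δ : Fin 2 → ℝ} (hδ0 : 0 < δ 0)
    (hδα : δ 0 ≤ S.lo * α) (hδ1 : 0 < δ 1) (hδ1' : δ 1 ≤ 1) :
    PackGe (S.vstrip x α) δ
      (S.lo ^ s * S.lo ^ s * S.lo ^ t * (α ^ s * δ 0 ^ (-s) * δ 1 ^ (-t))) := by
  have hlo := S.lo_pos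
  have key : ∀ n : ℕ, ∀ x ∈ S.K, ∀ α : ℝ, 0 < α → α ≤ 1 / S.lo → ∀ δ : Fin 2 → ℝ, 0 < δ 0 →
      δ 0 ≤ S.lo * α → 0 < δ 1 → δ 1 ≤ 1 → S.hi ^ n ≤ δ 1 →
      PackGe (S.vstrip x α) δ
        (S.lo ^ s * S.lo ^ s * S.lo ^ t * (α ^ s * δ 0 ^ (-s) * δ 1 ^ (-t))) := by
    have hbase : ∀ x ∈ S.K, ∀ α : ℝ, 0 < α → α ≤ 1 / S.lo → ∀ δ : Fin 2 → ℝ, 0 < δ 0 →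
        δ 0 ≤ S.lo * α → S.lo ≤ δ 1 → δ 1 ≤ 1 →
        PackGe (S.vstrip x α) δ
          (S.lo ^ s * S.lo ^ s * S.lo ^ t * (α ^ s * δ 0 ^ (-s) * δ 1 ^ (-t))) := by
      intro x hx α h0 h1 δ h2 h3 h4 h5
      have p1 : 0 < δ 1 := hlo.trans_le h4
      refine (PackGe.of_shadow (fun p hp => S.K_cube p hp.1) ?_ 0
        (S.packGe_shadow_vstrip hs hsum hx h0 h1 h2 h3)).mono le_rfl ?_
      · rw [Fin.forall_fin_two]
        refine ⟨⟨h2, h3.trans ?_⟩, p1, h5⟩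
        rwa [le_div_iff₀' hlo] at h1
      · have : S.lo ^ t * δ 1 ^ (-t) ≤ 1 := by
          rw [Real.rpow_neg p1.le, ← div_eq_mul_inv, div_le_one (by positivity)]
          exact Real.rpow_le_rpow hlo.le h4 ht
        calc _ = (S.lo ^ s * S.lo ^ s * (α ^ s * δ 0 ^ (-s))) * (S.lo ^ t * δ 1 ^ (-t)) := by ring
          _ ≤ _ := mul_le_of_le_one_right (by positivity) this
    intro n
    induction n with
    | zero =>
      exact fun x hx α h0 h1 δ h2 h3 _ h5 h6 => hbase x hx α h0 h1 δ h2 h3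
        (S.lo_lt_one.le.trans (by simpa using h6)) h5
    | succ n ih =>
      intro x hx α h0 h1 δ h2 h3 h4 h5 h6
      rcases le_or_gt S.lo (δ 1) with h | h
      · exact hbase x hx α h0 h1 δ h2 h3 h h5
      rcases le_or_gt 1 α with h' | h'
      · have h1' : S.lo * α ≤ 1 := by rwa [le_div_iff₀' hlo] at h1
        rw [S.vstrip_eq hx h']
        refine (S.packGe_whole hs ht hsum htsum
          (Fin.forall_fin_two.2 ⟨⟨h2, h3.trans h1'⟩, h4, h5⟩)).mono le_rfl ?_
        have : S.lo ^ s * α ^ s ≤ 1 := by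
          rw [← Real.mul_rpow hlo.le h0.le]
          exact Real.rpow_le_one (by positivity) h1' hs
        calc _ = (S.lo ^ s * S.lo ^ t * (δ 0 ^ (-s) * δ 1 ^ (-t))) * (S.lo ^ s * α ^ s) := by ring
          _ ≤ _ := mul_le_of_le_one_right (by positivity) this
      obtain ⟨i, y, hy, rfl⟩ := S.exists_preimage hx
      have hc := S.c_pos i 0
      have hstep : ∀ i' : {i' // S.col i' = S.col i}, PackGe (S.vstrip y (α / S.c i 0)) (δ / S.c i')
          (S.lo ^ s * S.lo ^ s * S.lo ^ t * (α ^ s * δ 0 ^ (-s) * δ 1 ^ (-t)) * S.c i' 1 ^ t) := by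
        rintro ⟨i', hi'⟩
        have hc1 := S.c_pos i' 1
        have e0 : S.c i' 0 = S.c i 0 := by rw [S.c_zero, S.c_zero, hi']
        have := ih y hy (α / S.c i 0) (by positivity)
          (div_le_div₀ zero_le_one h'.le hlo (S.lo_le i 0)) (δ / S.c i')
          (div_pos h2 (S.c_pos i' 0)) ?_ (div_pos h4 hc1)
          ((div_le_one hc1).2 (h.le.trans (S.lo_le i' 1))) (S.pow_le_div i' 1 h6)
        · refine this.mono le_rfl (le_of_eq ?_)
          simp only [Pi.div_apply]
          rw [e0, div_rpow_neg h2 hc, div_rpow_neg h4 hc1, Real.div_rpow h0.le hc.le]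
          have : S.c i 0 ^ s ≠ 0 := by positivity
          field_simp
        · simp only [Pi.div_apply]
          rw [e0, ← mul_div_assoc]
          gcongr
      refine (PackGe.iUnion (I := {i' // S.col i' = S.col i}) (c := fun i' => S.c i')
        (a := fun i' => S.a i') (fun i' => S.c_pos i') (fun i' => S.a_nonneg i')
        (fun i' => S.add_le i') (fun i' i'' h => S.sep (fun e => h (Subtype.ext e)))
        (fun i' p hp => S.map_mem_vstrip i'.2 hp) (Fin.forall_fin_two.2 ⟨h2, h4⟩)
        hstep).mono le_rfl ?_
      rw [← Finset.mul_sum]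
      exact le_mul_of_one_le_right (by positivity) (htsum _)
  obtain ⟨n, hn⟩ := exists_pow_lt_of_lt_one hδ1 S.hi_lt
  exact key n x hx α hα hα1 δ hδ0 hδα hδ1 hδ1' hn.le

/-- The lower bound for the part of `K` in a box whose vertical half-side `β` has reached the unit
scale, that is, in a strip. -/
lemma packGe_inBox [Fintype ι] [Fintype κ] [DecidableEq κ] (hs : 0 ≤ s) (ht : 0 ≤ t) (hsum : 1 ≤ ∑ k, S.width k ^ s)
    (htsum : ∀ k, 1 ≤ ∑ i : {i // S.col i = k}, S.c i 1 ^ t) {x : Fin 2 → ℝ} (hx : x ∈ S.K)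
    {α : Fin 2 → ℝ} (hα : ∀ l, 0 < α l ∧ α l ≤ 1 / S.lo) (hα1 : 1 ≤ α 1) {lam : ℝ}
    (hlam : 1 / S.lo ≤ lam) :
    PackGe (inBox S.K x α) (fun l => α l / lam)
      (S.lo ^ s * S.lo ^ s * S.lo ^ t * S.lo ^ t * lam ^ (s + t)) := by
  have hlo := S.lo_pos
  have hl0 : 0 < lam := (by positivity : 0 < 1 / S.lo).trans_le hlam
  have p0 := (hα 0).1
  have p1 := (hα 1).1
  have hlam' : 1 ≤ S.lo * lam := by rwa [div_le_iff₀' hlo] at hlam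
  refine (S.packGe_vstrip hs ht hsum htsum hx p0 (hα 0).2 (δ := fun l => α l / lam)
    (by positivity) ?_ (by positivity) ?_).mono ?_ ?_
  · rw [div_le_iff₀ hl0]
    nlinarith
  · rw [div_le_one hl0]
    exact (hα 1).2.trans hlam
  · intro p hp
    refine ⟨hp.1, Fin.forall_fin_two.2 ⟨hp.2, abs_le.2 ?_⟩⟩
    have h1 := S.K_cube x hx 1
    have h2 := S.K_cube p hp.1 1
    constructor <;> linarith
  · have h1 : S.lo ^ t ≤ α 1 ^ (-t) := by
      rw [Real.rpow_neg p1.le, ← Real.inv_rpow p1.le]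
      refine Real.rpow_le_rpow hlo.le ?_ ht
      rw [le_inv_comm₀ hlo p1, ← one_div]
      exact (hα 1).2
    have e : α 0 ^ s * (α 0 / lam) ^ (-s) * (α 1 / lam) ^ (-t) = α 1 ^ (-t) * lam ^ (s + t) := by
      rw [div_rpow_neg p0 hl0, div_rpow_neg p1 hl0, Real.rpow_neg p0.le, Real.rpow_add hl0]
      have : α 0 ^ s ≠ 0 := by positivity
      field_simp
    rw [e]
    calc _ = S.lo ^ s * S.lo ^ s * S.lo ^ t * (S.lo ^ t * lam ^ (s + t)) := by ring
      _ ≤ _ := by gcongr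

/-- Zooming in: a counting bound for boxes that have reached the unit scale in one direction
transfers to all smaller boxes centred at points of `K`, because
`inBox K (f_i x) α ⊇ f_i (inBox K x (α / c_i))`. The relation `P` on the half-sides of the boxes,
preserved by the zoom, allows for the assumption that the vertical side is the longer one. -/
lemma packGe_zoom {P : (Fin 2 → ℝ) → Prop} (hP : ∀ α i, P α → P (α / S.c i)) {lam X : ℝ}
    (hlam : 0 < lam)
    (hunit : ∀ x ∈ S.K, ∀ α : Fin 2 → ℝ, (∀ l, 0 < α l ∧ α l ≤ 1 / S.lo) → P α →
      (1 ≤ α 0 ∨ 1 ≤ α 1) → PackGe (inBox S.K x α) (fun l => α l / lam) X)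
    {x : Fin 2 → ℝ} (hx : x ∈ S.K) {α : Fin 2 → ℝ} (hα : ∀ l, 0 < α l ∧ α l ≤ 1) (hPα : P α) :
    PackGe (inBox S.K x α) (fun l => α l / lam) X := by
  have hlo := S.lo_pos
  have key : ∀ n : ℕ, ∀ x ∈ S.K, ∀ α : Fin 2 → ℝ, (∀ l, 0 < α l ∧ α l ≤ 1 / S.lo) → P α →
      S.hi ^ n ≤ α 0 → PackGe (inBox S.K x α) (fun l => α l / lam) X := by
    intro n
    induction n with
    | zero => exact fun x hx α h0 h1 h2 => hunit x hx α h0 h1 (Or.inl (by simpa using h2))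
    | succ n ih =>
      intro x hx α h0 h1 h2
      by_cases h : 1 ≤ α 0 ∨ 1 ≤ α 1
      · exact hunit x hx α h0 h1 h
      push Not at h
      obtain ⟨i, y, hy, rfl⟩ := S.exists_preimage hx
      have hα1 : ∀ l, α l ≤ 1 := Fin.forall_fin_two.2 ⟨h.1.le, h.2.le⟩
      have := ih y hy (α / S.c i) (fun l => ⟨div_pos (h0 l).1 (S.c_pos i l),
        div_le_div₀ zero_le_one (hα1 l) hlo (S.lo_le i l)⟩) (hP α i h1) (S.pow_le_div i 0 h2)
      refine PackGe.image (S.c_pos i) (S.a_nonneg i) (S.add_le i) (L := inBox S.K y (α / S.c i))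
        ?_ (fun l => div_pos (h0 l).1 hlam) ?_
      · intro p hp
        refine ⟨S.map_mem i hp.1, fun l => ?_⟩
        have h3 := hp.2 l
        have hc := S.c_pos i l
        rw [Pi.div_apply, le_div_iff₀' hc] at h3
        simp only [boxMap]
        rw [add_sub_add_right_eq_sub, ← mul_sub, abs_mul, abs_of_pos hc]
        exact h3
      · have e : (fun l => α l / lam) / S.c i = fun l => (α / S.c i) l / lam := by
          funext l
          simp only [Pi.div_apply]
          exact div_right_comm _ _ _
        rwa [e]
  obtain ⟨n, hn⟩ := exists_pow_lt_of_lt_one (hα 0).1 S.hi_lt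
  exact key n x hx α (fun l => ⟨(hα l).1, (hα l).2.trans (by
    rw [le_div_iff₀ hlo]; linarith [S.lo_lt_one])⟩) hPα hn.le

end Lower

end ColumnCarpet

/-! ### Pieces as thin as a given column -/

namespace ColumnCarpet

variable {ι κ : Type*} (S : ColumnCarpet ι κ)

/-- The union of the images of `E` under the maps of the column `k`. -/
def colImage (k : κ) (E : Set (Fin 2 → ℝ)) : Set (Fin 2 → ℝ) :=
  {p | ∃ i, S.col i = k ∧ ∃ x ∈ E, boxMap (S.c i) (S.a i) x = p}

lemma colImage_iterate_subset (k : κ) {E : Set (Fin 2 → ℝ)} (hE : E ⊆ S.K) (m : ℕ) :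
    (S.colImage k)^[m] E ⊆ S.K := by
  induction m with
  | zero => exact hE
  | succ m ih =>
    rw [Function.iterate_succ_apply']
    rintro p ⟨i, -, x, hx, rfl⟩
    exact S.map_mem i (ih hx)

lemma boxMap_iterate_mem {i : ι} {k : κ} (hi : S.col i = k) {E : Set (Fin 2 → ℝ)} {x : Fin 2 → ℝ}
    (hx : x ∈ E) (m : ℕ) : (boxMap (S.c i) (S.a i))^[m] x ∈ (S.colImage k)^[m] E := by
  induction m with
  | zero => exact hx
  | succ m ih =>
    rw [Function.iterate_succ_apply', Function.iterate_succ_apply']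
    exact ⟨i, hi, _, ih, rfl⟩

section Counting

variable {s t : ℝ}

lemma coverLe_shadow_zero [Fintype κ] (hs : 0 ≤ s) (hsum : ∑ k, S.width k ^ s ≤ 1) {δ : ℝ}
    (hδ : 0 < δ) (hδ1 : δ ≤ 1 / S.lo) :
    CoverLe (shadow 0 S.K) (fun _ => δ) (S.lo ^ (-s) * δ ^ (-s)) := by
  refine coverLe_selfSimilar (c := S.width) (a := S.left) S.lo_pos S.hi_lt
    (fun k => ⟨S.lo_le_width k, S.width_le_hi k⟩) hs hsum (S.shadow_cube le_rfl 0) ?_ hδ hδ1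
  rintro p ⟨x, hx, e⟩
  obtain ⟨i, y, hy, rfl⟩ := S.exists_preimage hx
  refine ⟨S.col i, fun _ => y 0, ⟨y, hy, rfl⟩, ?_⟩
  funext u
  rw [← e]
  simp [boxMap, S.c_zero, S.a_zero]

lemma coverLe_shadow_iterate [Fintype κ] (hs : 0 ≤ s) (hsum : ∑ k, S.width k ^ s ≤ 1) (k : κ)
    (m : ℕ) {δ : ℝ} (hδ : 0 < δ) (hδ1 : δ ≤ S.width k ^ m) :
    CoverLe (shadow 0 ((S.colImage k)^[m] S.K)) (fun _ => δ)
      (S.lo ^ (-s) * (δ / S.width k ^ m) ^ (-s)) := by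
  have hw := S.width_pos k
  induction m generalizing δ with
  | zero =>
    have hlo := S.lo_pos
    simpa using S.coverLe_shadow_zero hs hsum hδ (le_trans (by simpa using hδ1) (by
      rw [le_div_iff₀ hlo]; linarith [S.lo_lt_one]))
  | succ m ih =>
    have := ih (δ := δ / S.width k) (by positivity) (by rwa [div_le_iff₀ hw, ← pow_succ])
    rw [div_div, ← pow_succ'] at this
    refine CoverLe.image (c := fun _ => S.width k) (a := fun _ => S.left k) (fun _ => hw) ?_ this
    rintro p ⟨x, hx, e⟩
    rw [Function.iterate_succ_apply'] at hx
    obtain ⟨i, rfl, y, hy, rfl⟩ := hx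
    refine ⟨fun _ => y 0, ⟨y, hy, rfl⟩, ?_⟩
    funext u
    rw [← e]
    simp [boxMap, S.c_zero, S.a_zero]

/-- Upper counting bound for the part of `K` in the `m`-fold column over `k`, at heights `δ₁` that
are reached before the column word is used up. -/
lemma coverLe_iterate [Fintype ι] [Fintype κ] [DecidableEq κ] (hs : 0 ≤ s) (ht : 0 ≤ t)
    (hsum : ∑ k, S.width k ^ s ≤ 1) (k : κ)
    (htsum : ∑ i : {i // S.col i = k}, S.c i 1 ^ t ≤ 1) (m : ℕ) {δ : Fin 2 → ℝ} (hδ0 : 0 < δ 0)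
    (hδ0' : δ 0 ≤ S.width k ^ m) (hδ1 : S.hi ^ m ≤ δ 1) (hδ1' : δ 1 ≤ 1 / S.lo) :
    CoverLe ((S.colImage k)^[m] S.K) δ
      (S.lo ^ (-s) * S.lo ^ (-t) * ((δ 0 / S.width k ^ m) ^ (-s) * δ 1 ^ (-t))) := by
  have hw := S.width_pos k
  have hlo := S.lo_pos
  have hbase : ∀ m : ℕ, ∀ δ : Fin 2 → ℝ, 0 < δ 0 → δ 0 ≤ S.width k ^ m → 1 ≤ δ 1 →
      δ 1 ≤ 1 / S.lo → CoverLe ((S.colImage k)^[m] S.K) δ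
      (S.lo ^ (-s) * S.lo ^ (-t) * ((δ 0 / S.width k ^ m) ^ (-s) * δ 1 ^ (-t))) := by
    intro m δ h0 h1 h2 h3
    have p1 : 0 < δ 1 := by linarith
    refine (CoverLe.of_shadow
      (fun x hx => S.K_cube x (S.colImage_iterate_subset k le_rfl m hx)) 0 ?_
      (S.coverLe_shadow_iterate hs hsum k m h0 h1)).mono le_rfl ?_
    · rw [Fin.forall_fin_two]
      exact ⟨fun h => absurd rfl h, fun _ => h2⟩
    · have h4 : 1 ≤ S.lo ^ (-t) * δ 1 ^ (-t) := by
        rw [← Real.mul_rpow hlo.le p1.le]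
        refine Real.one_le_rpow_of_pos_of_le_one_of_nonpos (by positivity) ?_ (by linarith)
        rwa [le_div_iff₀' hlo] at h3
      calc _ ≤ (S.lo ^ (-s) * (δ 0 / S.width k ^ m) ^ (-s)) * (S.lo ^ (-t) * δ 1 ^ (-t)) :=
            le_mul_of_one_le_right (by positivity) h4
        _ = _ := by ring
  induction m generalizing δ with
  | zero => exact hbase 0 δ hδ0 hδ0' (by simpa using hδ1) hδ1'
  | succ m ih =>
    rcases le_or_gt 1 (δ 1) with h | h
    · exact hbase _ δ hδ0 hδ0' h hδ1'
    have p1 : 0 < δ 1 := by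
      obtain ⟨i, -⟩ := S.col_surj k
      exact (pow_pos (S.hi_pos i) _).trans_le hδ1
    have hstep : ∀ i : {i // S.col i = k}, CoverLe ((S.colImage k)^[m] S.K) (δ / S.c i)
        (S.lo ^ (-s) * S.lo ^ (-t) * ((δ 0 / S.width k ^ (m + 1)) ^ (-s) * δ 1 ^ (-t)) *
          S.c i 1 ^ t) := by
      rintro ⟨i, hi⟩
      have hc1 := S.c_pos i 1
      have e0 : S.c i 0 = S.width k := by rw [S.c_zero, hi]
      refine (ih (δ := δ / S.c i) (div_pos hδ0 (S.c_pos i 0)) ?_ (S.pow_le_div i 1 hδ1)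
        (div_le_div₀ zero_le_one h.le hlo (S.lo_le i 1))).mono le_rfl (le_of_eq ?_)
      · simp only [Pi.div_apply]
        rwa [e0, div_le_iff₀ hw, ← pow_succ]
      · simp only [Pi.div_apply]
        rw [e0, div_div, ← pow_succ', div_rpow_neg p1 hc1]
        ring
    rw [Function.iterate_succ_apply']
    refine (CoverLe.iUnion (I := {i // S.col i = k}) (c := fun i => S.c i) (a := fun i => S.a i)
      (fun i => S.c_pos i) ?_ hstep).mono le_rfl ?_
    · rintro p ⟨i, hi, x, hx, rfl⟩
      exact ⟨⟨i, hi⟩, x, hx, rfl⟩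
    · rw [← Finset.mul_sum]
      have := div_pos hδ0 (pow_pos hw (m + 1))
      exact mul_le_of_le_one_right (by positivity) htsum

end Counting

section Isolation

/-- `K` coincides with `E` in the open vertical strip of half-width `ρ` about the abscissa `w`, and
this strip is well inside the square unless there is only one column. -/
def Isolated (E : Set (Fin 2 → ℝ)) (w ρ : ℝ) : Prop :=
  (Subsingleton κ ∨ (ρ ≤ w ∧ w ≤ 1 - ρ)) ∧ ∀ p ∈ S.K, |p 0 - w| < ρ → p ∈ E

lemma Isolated.colImage {E : Set (Fin 2 → ℝ)} {x : Fin 2 → ℝ} {ρ : ℝ} (h : S.Isolated E (x 0) ρ)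
    {i : ι} {k : κ} (hi : S.col i = k) :
    S.Isolated (S.colImage k E) (boxMap (S.c i) (S.a i) x 0) (ρ * S.width k) := by
  have hw := S.width_pos k
  have e : boxMap (S.c i) (S.a i) x 0 = S.width k * x 0 + S.left k := by
    simp [boxMap, S.c_zero, S.a_zero, hi]
  rw [e]
  obtain ⟨h1, h2⟩ := h
  refine ⟨h1.imp id fun h => ?_, ?_⟩
  · have h3 := S.left_nonneg k
    have h4 := S.left_add_width_le k
    constructor <;> nlinarith
  · intro p hp hpw
    obtain ⟨i', y, hy, rfl⟩ := S.exists_preimage hp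
    have e' : boxMap (S.c i') (S.a i') y 0 = S.width (S.col i') * y 0 + S.left (S.col i') := by
      simp [boxMap, S.c_zero, S.a_zero]
    rw [e'] at hpw
    have hcol : S.col i' = k := by
      by_contra hne
      rcases h1 with h1 | h1
      · exact hne (Subsingleton.elim _ _)
      have hy0 := S.K_cube y hy 0
      have hw' := S.width_pos (S.col i')
      have hpw' := abs_lt.1 hpw
      rcases S.sep_col _ _ hne with h | h <;> nlinarith
    refine ⟨i', hcol, y, h2 y hy ?_, rfl⟩
    rw [hcol, add_sub_add_right_eq_sub, ← mul_sub, abs_mul, abs_of_pos hw, mul_comm] at hpw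
    exact lt_of_mul_lt_mul_right hpw hw.le

lemma Isolated.iterate {E : Set (Fin 2 → ℝ)} {x : Fin 2 → ℝ} {ρ : ℝ} (h : S.Isolated E (x 0) ρ)
    {i : ι} {k : κ} (hi : S.col i = k) (n : ℕ) :
    S.Isolated ((S.colImage k)^[n] E) ((boxMap (S.c i) (S.a i))^[n] x 0)
      (ρ * S.width k ^ n) := by
  induction n with
  | zero => simpa using h
  | succ n ih =>
    rw [Function.iterate_succ_apply', Function.iterate_succ_apply', pow_succ, ← mul_assoc]
    exact ih.colImage S hi

/-- A point of `K` off the two vertical sides of the square exists unless there is only one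
column. -/
lemma exists_isolated : ∃ z ∈ S.K, ∃ ρ : ℝ, 0 < ρ ∧ ρ ≤ 1 ∧ S.Isolated S.K (z 0) ρ := by
  obtain ⟨x, hx⟩ := S.K_ne
  by_cases hκ : Subsingleton κ
  · exact ⟨x, hx, 1, one_pos, le_rfl, Or.inl hκ, fun p hp _ => hp⟩
  rw [not_subsingleton_iff_nontrivial] at hκ
  obtain ⟨k, k', hne⟩ := hκ.exists_pair_ne
  obtain ⟨k, k', hkk⟩ : ∃ k k', S.left k + S.width k ≤ S.left k' := by
    rcases S.sep_col k k' hne with h | h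
    · exact ⟨k, k', h⟩
    · exact ⟨k', k, h⟩
  obtain ⟨i, rfl⟩ := S.col_surj k
  obtain ⟨i', rfl⟩ := S.col_surj k'
  -- the right column inside the left one touches neither vertical side
  refine ⟨_, S.map_mem i (S.map_mem i' hx), ?_⟩
  have e : boxMap (S.c i) (S.a i) (boxMap (S.c i') (S.a i') x) 0 =
      S.width (S.col i) * (S.width (S.col i') * x 0 + S.left (S.col i')) + S.left (S.col i) := by
    simp [boxMap, S.c_zero, S.a_zero]
  rw [e]
  have hw := S.width_pos (S.col i)
  have hw' := S.width_pos (S.col i')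
  have h1 := S.left_nonneg (S.col i)
  have h2 := S.left_add_width_le (S.col i')
  have hx0 := S.K_cube x hx 0
  have h3 : 0 ≤ S.width (S.col i') * x 0 := mul_nonneg hw'.le hx0.1
  have h4 : S.width (S.col i') * x 0 ≤ S.width (S.col i') := mul_le_of_le_one_right hw'.le hx0.2
  have hlo := S.lo_pos
  have hlo1 := S.lo_lt_one
  have hlo2 : S.lo * S.lo ≤ S.lo := mul_le_of_le_one_right hlo.le hlo1.le
  have h5 := S.lo_le_width (S.col i)
  have h6 := S.lo_le_width (S.col i')
  refine ⟨S.lo * S.lo, by positivity, by linarith, Or.inr ⟨?_, ?_⟩, fun p hp _ => hp⟩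
  · have : S.lo * S.lo ≤ S.width (S.col i) * (S.width (S.col i') * x 0 + S.left (S.col i')) :=
      mul_le_mul h5 (by linarith) hlo.le hw.le
    linarith
  · have : S.width (S.col i) * (S.width (S.col i') * x 0 + S.left (S.col i')) ≤ S.width (S.col i) :=
      mul_le_of_le_one_right hw.le (by linarith)
    linarith

/-- Every deep column over `k` contains a point `z` from which no point of the column is almost at
vertical distance one. For a column of a single map this holds since the column is flat; with two
or more maps one takes `z` off the horizontal sides. -/
lemma exists_central (k : κ) : ∃ η : ℝ, 0 < η ∧ η ≤ 1 ∧ ∀ m : ℕ,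
    ∃ z ∈ (S.colImage k)^[m + 2] S.K,
      S.Isolated ((S.colImage k)^[m + 2] S.K) (z 0) (η * S.width k ^ (m + 2)) ∧
      ∀ y ∈ (S.colImage k)^[m + 2] S.K, |y 1 - z 1| ≤ 1 - η := by
  obtain ⟨w, hw, ρ, hρ, hρ1, hiso⟩ := S.exists_isolated
  have hwk := S.width_pos k
  have main : ∀ i i', S.col i = k → S.col i' = k → ∀ η : ℝ, 0 < η → η ≤ 1 →
      (∀ m : ℕ, ∀ u ∈ S.K, ∀ y ∈ (S.colImage k)^[m + 2] S.K,
        |y 1 - boxMap (S.c i) (S.a i) (boxMap (S.c i') (S.a i') u) 1| ≤ 1 - η) →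
      ∃ η : ℝ, 0 < η ∧ η ≤ 1 ∧ ∀ m : ℕ,
    ∃ z ∈ (S.colImage k)^[m + 2] S.K,
      S.Isolated ((S.colImage k)^[m + 2] S.K) (z 0) (η * S.width k ^ (m + 2)) ∧
      ∀ y ∈ (S.colImage k)^[m + 2] S.K, |y 1 - z 1| ≤ 1 - η := by
    intro i i' hi hi' η hη hη1 h
    refine ⟨min η ρ, lt_min hη hρ, (min_le_left _ _).trans hη1, fun m => ?_⟩
    have hm : (boxMap (S.c i) (S.a i))^[m] w ∈ (S.colImage k)^[m] S.K :=
      S.boxMap_iterate_mem hi hw m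
    refine ⟨boxMap (S.c i) (S.a i) (boxMap (S.c i') (S.a i') ((boxMap (S.c i) (S.a i))^[m] w)),
      ?_, ?_, fun y hy => ?_⟩
    · rw [Function.iterate_succ_apply', Function.iterate_succ_apply']
      exact ⟨i, hi, _, ⟨i', hi', _, hm, rfl⟩, rfl⟩
    · have h2 := ((hiso.iterate S hi m).colImage S hi').colImage S hi
      rw [Function.iterate_succ_apply', Function.iterate_succ_apply']
      have hle : min η ρ * S.width k ^ (m + 2) ≤ ρ * S.width k ^ m * S.width k * S.width k := by
        calc _ ≤ ρ * S.width k ^ (m + 2) := by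
              gcongr
              exact min_le_right _ _
          _ = _ := by ring
      refine ⟨h2.1.imp id fun h => ⟨hle.trans h.1, h.2.trans (by linarith)⟩,
        fun p hp hpz => h2.2 p hp (hpz.trans_le hle)⟩
    · exact (h m _ (S.colImage_iterate_subset k le_rfl m hm) y hy).trans
        (by linarith [min_le_left η ρ])
  by_cases htwo : ∃ i i', i ≠ i' ∧ S.col i = k ∧ S.col i' = k
  · obtain ⟨i, i', hi, hi', hii⟩ : ∃ i i', S.col i = k ∧ S.col i' = k ∧
        S.a i 1 + S.c i 1 ≤ S.a i' 1 := by
      obtain ⟨i, i', hne, hi, hi'⟩ := htwo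
      rcases S.sep_row i i' hne (hi.trans hi'.symm) with h | h
      · exact ⟨i, i', hi, hi', h⟩
      · exact ⟨i', i, hi', hi, h⟩
    have hlo := S.lo_pos
    have hlo2 : S.lo * S.lo ≤ S.lo := mul_le_of_le_one_right hlo.le S.lo_lt_one.le
    have h1 := S.a_nonneg i 1
    have h2 := S.add_le i' 1
    have h3 := S.lo_le i 1
    have h4 := S.lo_le i' 1
    refine main i i' hi hi' (S.lo * S.lo) (by positivity) (by linarith [S.lo_lt_one]) ?_
    intro m u hu y hy
    have hy1 := S.K_cube y (S.colImage_iterate_subset k le_rfl _ hy) 1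
    have hu1 := S.K_cube _ (S.map_mem i' hu) 1
    have hu2 := S.K_cube u hu 1
    have h5 : S.lo * S.lo ≤ S.c i 1 * boxMap (S.c i') (S.a i') u 1 := by
      refine mul_le_mul h3 ?_ hlo.le (S.c_pos i 1).le
      have := mul_nonneg (S.c_pos i' 1).le hu2.1
      simp only [boxMap]
      linarith
    have h6 : S.c i 1 * boxMap (S.c i') (S.a i') u 1 ≤ S.c i 1 :=
      mul_le_of_le_one_right (S.c_pos i 1).le hu1.2
    have e : boxMap (S.c i) (S.a i) (boxMap (S.c i') (S.a i') u) 1 =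
      S.c i 1 * boxMap (S.c i') (S.a i') u 1 + S.a i 1 := rfl
    rw [e, abs_le]
    constructor <;> linarith
  · obtain ⟨i, hi⟩ := S.col_surj k
    have honly : ∀ i', S.col i' = k → i' = i := fun i' hi' => by
      by_contra hne
      exact htwo ⟨i', i, hne, hi', hi⟩
    have hc := S.c_pos i 1
    have hc1 := (S.le_hi i 1).trans_lt S.hi_lt
    refine main i i hi hi (1 - S.c i 1) (by linarith) (by linarith) ?_
    intro m u hu y hy
    rw [Function.iterate_succ_apply'] at hy
    obtain ⟨i', hi', y', hy', rfl⟩ := hy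
    rw [honly i' hi']
    have h1 := S.K_cube y' (S.colImage_iterate_subset k le_rfl _ hy') 1
    have h2 := S.K_cube _ (S.map_mem i hu) 1
    rw [abs_le]
    simp only [boxMap] at h2 ⊢
    constructor <;> nlinarith

/-- Let `z` be as in `exists_central`, for a set `E`, and let the `i`-th rectangle be of least height
in its column. The rectangles of the `n`-fold column over `i` all have height at least `d_i ^ n`, so
that a point of the copy of `E` in another rectangle than the `n`-fold one of `i` has distance at
least `η d_i ^ n` from `f_i ^ n (z)`. -/
lemma mem_image_iterate_of_near {i : ι} (hmin : ∀ i', S.col i' = S.col i → S.c i 1 ≤ S.c i' 1)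
    {E : Set (Fin 2 → ℝ)} (hE : E ⊆ S.K) {z : Fin 2 → ℝ} {η : ℝ}
    (hη : ∀ y ∈ E, |y 1 - z 1| ≤ 1 - η) (n : ℕ) {p : Fin 2 → ℝ}
    (hp : p ∈ (S.colImage (S.col i))^[n] E)
    (hpz : |p 1 - (boxMap (S.c i) (S.a i))^[n] z 1| < η * S.c i 1 ^ n) :
    ∃ y ∈ E, (boxMap (S.c i) (S.a i))^[n] y = p := by
  have hd := S.c_pos i 1
  -- distance from the horizontal sides of the square
  have hE' : ∀ n : ℕ, ∀ p ∈ (S.colImage (S.col i))^[n] E, ∃ y ∈ E,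
      S.c i 1 ^ n * y 1 ≤ p 1 ∧ S.c i 1 ^ n * (1 - y 1) ≤ 1 - p 1 := by
    intro n
    induction n with
    | zero => exact fun p hp => ⟨p, hp, by simp⟩
    | succ n ih =>
      intro p hp
      rw [Function.iterate_succ_apply'] at hp
      obtain ⟨i', hi', q, hq, rfl⟩ := hp
      obtain ⟨y, hy, h1, h2⟩ := ih q hq
      refine ⟨y, hy, ?_⟩
      have hle := hmin i' hi'
      have hy0 := S.K_cube y (hE hy) 1
      have hq0 := S.K_cube q (S.colImage_iterate_subset _ hE _ hq) 1
      have ha := S.a_nonneg i' 1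
      have hac := S.add_le i' 1
      simp only [boxMap, pow_succ']
      constructor
      · nlinarith
      · nlinarith
  have hz' : ∀ n : ℕ, S.c i 1 ^ n * z 1 ≤ (boxMap (S.c i) (S.a i))^[n] z 1 ∧
      S.c i 1 ^ n * (1 - z 1) ≤ 1 - (boxMap (S.c i) (S.a i))^[n] z 1 := by
    intro n
    induction n with
    | zero => simp
    | succ n ih =>
      rw [Function.iterate_succ_apply', pow_succ']
      have ha := S.a_nonneg i 1
      have hac := S.add_le i 1
      simp only [boxMap] at ih ⊢
      constructor <;> nlinarith
  induction n generalizing p with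
  | zero => exact ⟨p, hp, rfl⟩
  | succ n ih =>
    rw [Function.iterate_succ_apply'] at hp hpz
    obtain ⟨i', hi', q, hq, rfl⟩ := hp
    set x := (boxMap (S.c i) (S.a i))^[n] z with hx
    by_cases hii : i' = i
    · subst hii
      obtain ⟨y, hy, e⟩ := ih hq (by
        simp only [boxMap] at hpz
        rw [add_sub_add_right_eq_sub, ← mul_sub, abs_mul, abs_of_pos hd, pow_succ', mul_left_comm]
          at hpz
        exact lt_of_mul_lt_mul_left hpz hd.le)
      exact ⟨y, hy, by rw [Function.iterate_succ_apply', e]⟩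
    · exfalso
      obtain ⟨y, hy, h1, h2⟩ := hE' n q hq
      obtain ⟨h3, h4⟩ := hz' n
      have h5 := abs_le.1 (hη y hy)
      have h6 := abs_lt.1 hpz
      have hle := hmin i' hi'
      have hpow : 0 < S.c i 1 ^ n := by positivity
      have hq0 := S.K_cube q (S.colImage_iterate_subset _ hE _ hq) 1
      simp only [boxMap, pow_succ'] at h6
      have g1 : S.c i 1 * (S.c i 1 ^ n * y 1) ≤ S.c i' 1 * q 1 :=
        (mul_le_mul_of_nonneg_left h1 hd.le).trans (mul_le_mul_of_nonneg_right hle hq0.1)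
      have g2 : S.c i 1 * (S.c i 1 ^ n * (1 - y 1)) ≤ S.c i' 1 * (1 - q 1) :=
        (mul_le_mul_of_nonneg_left h2 hd.le).trans
          (mul_le_mul_of_nonneg_right hle (by linarith))
      have g3 := mul_le_mul_of_nonneg_left h3 hd.le
      have g4 := mul_le_mul_of_nonneg_left h4 hd.le
      have hpp : 0 < S.c i 1 * S.c i 1 ^ n := by positivity
      have g5 : S.c i 1 * S.c i 1 ^ n * η ≤ S.c i 1 * S.c i 1 ^ n * (1 - (y 1 - z 1)) :=
        mul_le_mul_of_nonneg_left (by linarith) hpp.le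
      have g6 : S.c i 1 * S.c i 1 ^ n * η ≤ S.c i 1 * S.c i 1 ^ n * (1 + (y 1 - z 1)) :=
        mul_le_mul_of_nonneg_left (by linarith) hpp.le
      rcases S.sep_row i' i hii hi' with h | h <;> nlinarith

lemma coverLe_image_iterate (i : ι) {E : Set (Fin 2 → ℝ)} (n : ℕ) {δ : Fin 2 → ℝ} {X : ℝ}
    (h : CoverLe E (fun l => δ l / S.c i l ^ n) X) :
    CoverLe ((boxMap (S.c i) (S.a i))^[n] '' E) δ X := by
  induction n generalizing δ with
  | zero => simpa using h
  | succ n ih =>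
    refine CoverLe.image (c := S.c i) (a := S.a i) (S.c_pos i)
      (L := (boxMap (S.c i) (S.a i))^[n] '' E) ?_ (ih (δ := δ / S.c i) ?_)
    · rintro p ⟨x, hx, rfl⟩
      exact ⟨_, ⟨x, hx, rfl⟩, (Function.iterate_succ_apply' _ _ _).symm⟩
    · simpa only [Pi.div_apply, div_div, ← pow_succ'] using h

/-- Small pieces of `K` that are as thin as the column `k` allows: near the point `f_i ^ n (z)`,
where the `i`-th map contracts more strongly in the vertical direction, `K` is at scale `R` a copy
of a deep column over `k`. -/
lemma exists_coverLe_inBox [Fintype ι] [Fintype κ] [DecidableEq κ] {s t : ℝ} (hs : 0 ≤ s)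
    (ht : 0 ≤ t) (hsum : ∑ k, S.width k ^ s ≤ 1) (k : κ)
    (htsum : ∑ i : {i // S.col i = k}, S.c i 1 ^ t ≤ 1) {i : ι} (hi : S.c i 1 < S.c i 0)
    (hmin : ∀ i', S.col i' = S.col i → S.c i 1 ≤ S.c i' 1) :
    ∃ C : ℝ, 0 < C ∧ ∀ lam ρ : ℝ, 1 ≤ lam → 0 < ρ → ∃ R, 0 < R ∧ R ≤ ρ ∧ ∃ x ∈ S.K,
      CoverLe (inBox S.K x fun _ => R) (fun _ => R / lam) (C * lam ^ (s + t)) := by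
  obtain ⟨η, hη, hη1, hz⟩ := S.exists_central k
  have hlo := S.lo_pos
  have hw := S.width_pos k
  have hw1 : S.width k < 1 := (S.width_le_hi k).trans_lt S.hi_lt
  have hc := S.c_pos i 0
  have hd := S.c_pos i 1
  have hhi := S.hi_pos i
  set w := S.width k with hwdef
  set c := S.c i 0 with hcdef
  set d := S.c i 1 with hddef
  have hd1 : d < 1 := (S.le_hi i 1).trans_lt S.hi_lt
  refine ⟨S.lo ^ (-s) * S.lo ^ (-t) * ((η * w / 2) ^ (-s) * (η * w ^ 2 / 2) ^ (-t)),
    by positivity, fun lam ρ hlam hρ => ?_⟩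
  have hl0 : 0 < lam := by linarith
  -- the depth that brings the height of the pieces below `R / lam`
  obtain ⟨m₀, hm₀⟩ := exists_pow_lt_of_lt_one
    (show 0 < η * w ^ 2 / (2 * lam) by positivity) S.hi_lt
  have hr0 : 0 < d / c := by positivity
  have hr1 : d / c < 1 := (div_lt_one hc).2 hi
  obtain ⟨n, hn1, hn2⟩ : ∃ n : ℕ, (d / c) ^ n < w ^ (m₀ + 1) ∧ d ^ n < ρ := by
    have h1 := (tendsto_pow_atTop_nhds_zero_of_lt_one hr0.le hr1).eventually_lt_const
      (show 0 < w ^ (m₀ + 1) by positivity)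
    have h2 := (tendsto_pow_atTop_nhds_zero_of_lt_one hd.le hd1).eventually_lt_const hρ
    exact (h1.and h2).exists
  -- the depth that makes the width of the column comparable with the height of the rectangle
  obtain ⟨m, hm1, hm2⟩ := exists_nat_pow_near_of_lt_one (pow_pos hr0 n)
    (pow_le_one₀ hr0.le hr1.le) hw hw1
  have hmm : m₀ ≤ m := by
    by_contra hlt
    have : w ^ (m₀ + 1) ≤ w ^ (m + 1) := pow_le_pow_of_le_one hw.le hw1.le (by omega)
    linarith
  rw [div_pow] at hm1 hm2
  have hcn : 0 < c ^ n := by positivity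
  have hdn : 0 < d ^ n := by positivity
  rw [lt_div_iff₀ hcn] at hm1
  rw [div_le_iff₀ hcn] at hm2
  have hR1 : w ^ (m + 2) * c ^ n ≤ w * d ^ n := by
    calc w ^ (m + 2) * c ^ n = w * (w ^ (m + 1) * c ^ n) := by ring
      _ ≤ _ := by gcongr
  have hR2 : w ^ 2 * d ^ n ≤ w ^ (m + 2) * c ^ n := by
    calc w ^ 2 * d ^ n ≤ w ^ 2 * (w ^ m * c ^ n) := by gcongr
      _ = _ := by ring
  obtain ⟨z, hzE, hziso, hzgap⟩ := hz m
  set E := (S.colImage k)^[m + 2] S.K with hE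
  have hEK : E ⊆ S.K := S.colImage_iterate_subset k le_rfl _
  have hw2 : w ^ 2 ≤ 1 := pow_le_one₀ hw.le hw1.le
  have hη2 : η * w ^ 2 ≤ 1 := mul_le_one₀ hη1 (by positivity) hw2
  refine ⟨η * w ^ 2 / 2 * d ^ n, by positivity, ?_, (boxMap (S.c i) (S.a i))^[n] z,
    S.colImage_iterate_subset (S.col i) hEK n (S.boxMap_iterate_mem rfl hzE n), ?_⟩
  · refine le_trans ?_ hn2.le
    exact mul_le_of_le_one_left hdn.le (by linarith)
  set R := η * w ^ 2 / 2 * d ^ n with hR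
  have hRpos : 0 < R := by positivity
  have hRc : R < η * w ^ (m + 2) * c ^ n := by
    calc R < η * (w ^ 2 * d ^ n) := by
          rw [hR]
          have : 0 < η * (w ^ 2 * d ^ n) := by positivity
          linarith
      _ ≤ η * (w ^ (m + 2) * c ^ n) := by gcongr
      _ = _ := by ring
  have hRd : R < η * d ^ n := by
    have h1 : η * w ^ 2 / 2 < η := by nlinarith
    exact mul_lt_mul_of_pos_right h1 hdn
  have hsub : (inBox S.K ((boxMap (S.c i) (S.a i))^[n] z) fun _ => R) ⊆
      (boxMap (S.c i) (S.a i))^[n] '' E := by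
    rintro p ⟨hp, hpR⟩
    have h1 := (hziso.iterate S (rfl : S.col i = S.col i) n).2 p hp ((hpR 0).trans_lt (by
      rw [← S.c_zero]
      exact hRc))
    obtain ⟨y, hy, e⟩ := S.mem_image_iterate_of_near hmin hEK hzgap n h1 ((hpR 1).trans_lt hRd)
    exact ⟨y, hy, e⟩
  have hcov := S.coverLe_iterate hs ht hsum k htsum (m + 2) (δ := fun l => R / lam / S.c i l ^ n)
    (by positivity) ?_ ?_ ?_
  · refine (S.coverLe_image_iterate i n hcov).mono hsub ?_
    have e1 : R / lam / S.c i 1 ^ n = η * w ^ 2 / 2 / lam := by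
      rw [hR, ← hddef]
      field_simp
    have e0 : η * w / 2 / lam ≤ R / lam / S.c i 0 ^ n / w ^ (m + 2) := by
      rw [show R / lam / S.c i 0 ^ n / w ^ (m + 2) = R / (c ^ n * w ^ (m + 2)) / lam by
        rw [← hcdef]; field_simp]
      refine div_le_div_of_nonneg_right ?_ hl0.le
      rw [le_div_iff₀ (by positivity), hR]
      calc η * w / 2 * (c ^ n * w ^ (m + 2)) = η * w / 2 * (w ^ (m + 2) * c ^ n) := by ring
        _ ≤ η * w / 2 * (w * d ^ n) := by gcongr
        _ = _ := by ring
    have h0 : (R / lam / S.c i 0 ^ n / w ^ (m + 2)) ^ (-s) ≤ (η * w / 2) ^ (-s) * lam ^ s := by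
      rw [← div_rpow_neg (by positivity) hl0]
      exact Real.rpow_le_rpow_of_nonpos (by positivity) e0 (by linarith)
    simp only [← hwdef]
    rw [e1, div_rpow_neg (by positivity) hl0, Real.rpow_add hl0]
    calc _ ≤ S.lo ^ (-s) * S.lo ^ (-t) * ((η * w / 2) ^ (-s) * lam ^ s *
          ((η * w ^ 2 / 2) ^ (-t) * lam ^ t)) := by gcongr
      _ = _ := by ring
  · rw [div_div, div_le_iff₀ (by positivity)]
    calc R ≤ η * w ^ (m + 2) * c ^ n := hRc.le
      _ ≤ 1 * w ^ (m + 2) * (lam * c ^ n) := by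
        gcongr
        exact le_mul_of_one_le_left hcn.le hlam
      _ = _ := by rw [one_mul]
  · have e : R / lam / S.c i 1 ^ n = η * w ^ 2 / (2 * lam) := by
      rw [hR, ← hddef]
      field_simp
    rw [e]
    exact (pow_le_pow_of_le_one hhi.le S.hi_lt.le (by omega)).trans hm₀.le
  · have e : R / lam / S.c i 1 ^ n = η * w ^ 2 / (2 * lam) := by
      rw [hR, ← hddef]
      field_simp
    rw [e, div_le_div_iff₀ (by positivity) hlo]
    have := S.lo_lt_one
    nlinarith

end Isolation

end ColumnCarpet

/-! ### Self-affine carpets as column carpets, box dimensions -/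

namespace Division

variable (P : Division)

lemma left_nonneg (k : Fin P.n) : 0 ≤ P.left k :=
  P.pts_zero ▸ P.strictMono.monotone (Fin.zero_le _)

lemma left_add_length (k : Fin P.n) : P.left k + P.length k = P.pts k.succ := by
  simp [left, length]

lemma left_add_length_le_one (k : Fin P.n) : P.left k + P.length k ≤ 1 := by
  rw [left_add_length, ← P.pts_last]
  exact P.strictMono.monotone (Fin.le_last _)

lemma left_add_length_le {k k' : Fin P.n} (h : k < k') : P.left k + P.length k ≤ P.left k' := by
  rw [left_add_length]
  exact P.strictMono.monotone (Fin.succ_le_castSucc_iff.2 h)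

lemma sep {k k' : Fin P.n} (h : k ≠ k') :
    P.left k + P.length k ≤ P.left k' ∨ P.left k' + P.length k' ≤ P.left k :=
  (lt_or_gt_of_ne h).imp P.left_add_length_le P.left_add_length_le

end Division

/-- The coordinates of a point of the plane, permuted by `σ`; with `σ` the transposition, rows
become columns. -/
def coords (σ : Equiv.Perm (Fin 2)) (p : Plane) : Fin 2 → ℝ := fun l => p (σ l)

lemma abs_coord_sub_le (p q : Plane) (j : Fin 2) : |p j - q j| ≤ dist p q := by
  have := PiLp.dist_apply_le p q j
  rwa [Real.dist_eq] at this

lemma abs_coords_sub_le (σ : Equiv.Perm (Fin 2)) (p q : Plane) (j : Fin 2) :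
    |coords σ p j - coords σ q j| ≤ dist p q := abs_coord_sub_le p q (σ j)

lemma dist_le_of_coords (σ : Equiv.Perm (Fin 2)) {p q : Plane} {δ : ℝ} (hδ : 0 ≤ δ)
    (h : ∀ l, |coords σ p l - coords σ q l| ≤ δ) : dist p q ≤ 2 * δ := by
  have h' : ∀ j, |p j - q j| ≤ δ := fun j => by simpa [coords] using h (σ.symm j)
  rw [EuclideanSpace.dist_eq, Fin.sum_univ_two]
  refine Real.sqrt_le_iff.2 ⟨by positivity, ?_⟩
  rw [Real.dist_eq, Real.dist_eq]
  have h0 := h' 0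
  have h1 := h' 1
  nlinarith [abs_nonneg (p 0 - q 0), abs_nonneg (p 1 - q 1)]

namespace AffineIFS

variable {ι : Type*} {S : AffineIFS ι} {F : Set Plane}

lemma map_apply (i : ι) (p : Plane) (j : Fin 2) :
    S.map i p j = S.ratio i j * p j + S.shift i j := rfl

lemma IsAttractor.map_mem (hF : S.IsAttractor F) (i : ι) {p : Plane} (hp : p ∈ F) :
    S.map i p ∈ F := by
  rw [hF.2.2]
  exact Set.mem_iUnion.2 ⟨i, p, hp, rfl⟩

lemma IsAttractor.exists_preimage (hF : S.IsAttractor F) {p : Plane} (hp : p ∈ F) :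
    ∃ i, ∃ q ∈ F, S.map i q = p := by
  rw [hF.2.2] at hp
  obtain ⟨i, q, hq, e⟩ := Set.mem_iUnion.1 hp
  exact ⟨i, q, hq, e⟩

/-- The attractor lies in the unit square if the maps send the square into itself, since the
extreme values of a coordinate on `F` are attained. -/
lemma IsAttractor.mem_cube (hF : S.IsAttractor F) (h : ∀ i j, 0 ≤ S.shift i j ∧
    S.shift i j + S.ratio i j ≤ 1) {p : Plane} (hp : p ∈ F) (j : Fin 2) : 0 ≤ p j ∧ p j ≤ 1 := by
  have hcont : ContinuousOn (fun p : Plane => p j) F := by fun_prop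
  constructor
  · obtain ⟨q, hq, hmin⟩ := hF.2.1.exists_isMinOn hF.1 hcont
    refine le_trans ?_ (hmin hp)
    obtain ⟨i, q', hq', rfl⟩ := hF.exists_preimage hq
    have h1 := hmin hq'
    have h2 := S.ratio_mem i j
    have h3 := h i j
    simp only [Set.mem_ofPred_eq, map_apply] at h1 ⊢
    by_contra hneg
    push Not at hneg
    nlinarith [h2.1, h2.2]
  · obtain ⟨q, hq, hmax⟩ := hF.2.1.exists_isMaxOn hF.1 hcont
    refine (hmax hp : _).trans ?_
    obtain ⟨i, q', hq', rfl⟩ := hF.exists_preimage hq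
    have h1 := hmax hq'
    have h2 := S.ratio_mem i j
    have h3 := h i j
    simp only [Set.mem_ofPred_eq, map_apply] at h1 ⊢
    by_contra hneg
    push Not at hneg
    nlinarith [h2.1, h2.2]

/-- The fixed point of the `i`-th map. -/
def fixedPoint (S : AffineIFS ι) (i : ι) : Plane :=
  WithLp.toLp 2 fun j => S.shift i j / (1 - S.ratio i j)

lemma fixedPoint_eq (i : ι) (j : Fin 2) :
    S.ratio i j * S.fixedPoint i j + S.shift i j = S.fixedPoint i j := by
  have : 1 - S.ratio i j ≠ 0 := by linarith [(S.ratio_mem i j).2]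
  simp only [fixedPoint]
  field_simp
  ring

lemma map_eq_self_iff {i : ι} {q : Plane} : S.map i q = q ↔ q = S.fixedPoint i := by
  constructor
  · intro h
    ext j
    have h1 := congrArg (fun p : Plane => p j) h
    have h2 := S.fixedPoint_eq i j
    have h3 := (S.ratio_mem i j).2
    simp only [map_apply] at h1
    have : (1 - S.ratio i j) * (q j - S.fixedPoint i j) = 0 := by linarith
    rcases mul_eq_zero.1 this with h | h <;> linarith
  · rintro rfl
    ext j
    rw [map_apply, fixedPoint_eq]

lemma slice_eq (j : Fin 2) (i : ι) : S.slice j i F = {p ∈ F | p j = S.fixedPoint i j} := by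
  ext p
  simp only [slice, map_eq_self_iff, exists_eq_left, Set.mem_ofPred_eq]

lemma IsAttractor.fixedPoint_mem (hF : S.IsAttractor F) (i : ι) : S.fixedPoint i ∈ F := by
  obtain ⟨p, hp⟩ := hF.1
  let u : ℕ → Plane := fun n =>
    WithLp.toLp 2 fun j => S.fixedPoint i j + S.ratio i j ^ n * (p j - S.fixedPoint i j)
  have hu : ∀ n, u n ∈ F := by
    intro n
    induction n with
    | zero =>
      have : u 0 = p := by
        ext j
        simp [u]
      rwa [this]
    | succ n ih =>
      have : u (n + 1) = S.map i (u n) := by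
        ext j
        rw [map_apply]
        have := S.fixedPoint_eq i j
        simp only [u, pow_succ']
        linear_combination -this
      rw [this]
      exact hF.map_mem i ih
  refine hF.2.1.isClosed.mem_of_tendsto (f := u) (b := atTop) ?_ (Eventually.of_forall hu)
  refine ((PiLp.continuous_toLp 2 _).tendsto (fun j => S.fixedPoint i j)).comp
    (tendsto_pi_nhds.2 fun j => ?_)
  have := (tendsto_pow_atTop_nhds_zero_of_lt_one (S.ratio_mem i j).1.le
    (S.ratio_mem i j).2).mul_const (p j - S.fixedPoint i j)
  simpa using this.const_add (S.fixedPoint i j)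

/-- The column carpet `T` is the attractor `F` of `S` in the coordinates permuted by `σ`. -/
structure Models {κ : Type*} (S : AffineIFS ι) (F : Set Plane) (σ : Equiv.Perm (Fin 2))
    (T : ColumnCarpet ι κ) : Prop where
  c_eq : ∀ i l, T.c i l = S.ratio i (σ l)
  a_eq : ∀ i l, T.a i l = S.shift i (σ l)
  K_eq : T.K = coords σ '' F
  lo_eq : T.lo = ⨅ x : ι × Fin 2, S.ratio x.1 x.2

lemma exists_models [Finite ι] (hF : S.IsAttractor F) (σ : Equiv.Perm (Fin 2)) (P : Division)
    (k : ι → Fin P.n) (h0 : ∀ i, S.MapsOnto i (σ 0) P (k i))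
    (h1 : ∀ i, 0 ≤ S.shift i (σ 1) ∧ S.shift i (σ 1) + S.ratio i (σ 1) ≤ 1)
    (hsep : ∀ i i', i ≠ i' → k i = k i' →
      S.shift i (σ 1) + S.ratio i (σ 1) ≤ S.shift i' (σ 1) ∨
      S.shift i' (σ 1) + S.ratio i' (σ 1) ≤ S.shift i (σ 1)) :
    ∃ T : ColumnCarpet ι (Set.range k), S.Models F σ T := by
  have hne : Nonempty ι := by
    obtain ⟨p, hp⟩ := hF.1
    exact ⟨(hF.exists_preimage hp).choose⟩
  obtain ⟨x₁, hx₁⟩ := exists_eq_ciInf_of_finite (f := fun x : ι × Fin 2 => S.ratio x.1 x.2)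
  obtain ⟨⟨i₂, l₂⟩, hhi⟩ := Finite.exists_max fun x : ι × Fin 2 => S.ratio x.1 (σ x.2)
  have hl : ∀ i l, 0 ≤ S.shift i (σ l) ∧ S.shift i (σ l) + S.ratio i (σ l) ≤ 1 := by
    intro i
    refine Fin.forall_fin_two.2 ⟨?_, h1 i⟩
    rw [(h0 i).1, (h0 i).2]
    exact ⟨P.left_nonneg _, P.left_add_length_le_one _⟩
  have hcube : ∀ i j, 0 ≤ S.shift i j ∧ S.shift i j + S.ratio i j ≤ 1 := by
    intro i j
    have := hl i (σ.symm j)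
    rwa [σ.apply_symm_apply] at this
  refine ⟨{
    c := fun i l => S.ratio i (σ l)
    a := fun i l => S.shift i (σ l)
    col := Set.rangeFactorization k
    width := fun x => P.length x.1
    left := fun x => P.left x.1
    lo := ⨅ x : ι × Fin 2, S.ratio x.1 x.2
    hi := S.ratio i₂ (σ l₂)
    K := coords σ '' F
    col_surj := Set.rangeFactorization_surjective
    c_zero := fun i => (h0 i).2
    a_zero := fun i => (h0 i).1
    lo_pos := hx₁ ▸ (S.ratio_mem _ _).1
    lo_le := fun i l => ciInf_le (Set.finite_range _).bddBelow (i, σ l)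
    le_hi := fun i l => hhi (i, l)
    hi_lt := (S.ratio_mem _ _).2
    a_nonneg := fun i l => (hl i l).1
    add_le := fun i l => (hl i l).2
    sep_col := fun x x' h => P.sep fun e => h (Subtype.ext e)
    sep_row := fun i i' h e => hsep i i' h (congrArg Subtype.val e)
    K_ne := hF.1.image _
    K_cube := ?_
    K_eq := ?_ }, fun _ _ => rfl, fun _ _ => rfl, rfl, rfl⟩
  · rintro _ ⟨p, hp, rfl⟩ l
    exact hF.mem_cube hcube hp (σ l)
  · ext q
    simp only [Set.mem_iUnion]
    constructor
    · rintro ⟨p, hp, rfl⟩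
      obtain ⟨i, p', hp', rfl⟩ := hF.exists_preimage hp
      exact ⟨i, _, ⟨p', hp', rfl⟩, rfl⟩
    · rintro ⟨i, _, ⟨p, hp, rfl⟩, rfl⟩
      exact ⟨_, hF.map_mem i hp, rfl⟩

end AffineIFS

section BoxDimensions

variable {ι κ : Type*} {S : AffineIFS ι} {F : Set Plane} {σ : Equiv.Perm (Fin 2)}
  {T : ColumnCarpet ι κ}

lemma AffineIFS.Models.hasBoxDim_proj [Fintype κ] (hT : S.Models F σ T) {s : ℝ} (hs : 0 ≤ s)
    (hsum : ∑ k, T.width k ^ s = 1) : HasBoxDim (proj (σ 0) F) s := by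
  have hlo := T.lo_pos
  have himg : (fun (x : ℝ) (_ : Unit) => x) '' proj (σ 0) F = shadow 0 T.K := by
    rw [hT.K_eq]
    ext q
    constructor
    · rintro ⟨_, ⟨p, hp, rfl⟩, rfl⟩
      exact ⟨_, ⟨p, hp, rfl⟩, rfl⟩
    · rintro ⟨_, ⟨p, hp, rfl⟩, e⟩
      exact ⟨_, ⟨p, hp, rfl⟩, funext fun _ => e⟩
  refine hasBoxDim_of_bounds (A := T.lo ^ s / 7) (B := T.lo ^ (-s) * (1 / 3) ^ (-s))
    (by positivity) (by positivity) (fun r h0 h1 => ?_) (fun r h0 h1 => ?_)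
  · have := PackGe.le_coverNumber (φ := fun (x : ℝ) (_ : Unit) => x) (E := proj (σ 0) F)
      (fun x y _ => (Real.dist_eq x y).ge) h0 1 h0.le (by simp)
      (himg ▸ T.packGe_shadow_zero hs hsum.ge h0 h1.le)
    convert! this using 2
    norm_num
    ring
  · have := CoverLe.coverNumber_le (r := r) (φ := fun (x : ℝ) (_ : Unit) => x) (E := proj (σ 0) F)
      (δ := r / 3) (fun x _ y _ h => by
        have := h ()
        rw [Real.dist_eq]
        linarith) (himg ▸ T.coverLe_shadow_zero hs hsum.le (δ := r / 3) (by positivity) (by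
          rw [le_div_iff₀ hlo]
          nlinarith [T.lo_lt_one]))
    convert! this using 2
    rw [div_eq_mul_one_div r 3, Real.mul_rpow h0.le (by norm_num)]
    ring

/-- The slice through a fixed point is self-similar under the maps of one column, because the
abscissa of the fixed point belongs to no other column: a fixed point on the boundary of its column
lies on the boundary of the square. -/
lemma AffineIFS.Models.hasBoxDim_slice [Fintype ι] [DecidableEq κ] (hF : S.IsAttractor F)
    (hT : S.Models F σ T) {t : ℝ} (ht : 0 ≤ t) (i : ι)
    (htsum : ∑ i' : {i' // T.col i' = T.col i}, T.c i' 1 ^ t = 1) :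
    HasBoxDim (S.slice (σ 0) i F) t := by
  have hlo := T.lo_pos
  set ξ := S.fixedPoint i (σ 0) with hξ
  let φ : Plane → Unit → ℝ := fun p _ => p (σ 1)
  have hw := T.width_pos (T.col i)
  have hw1 := (T.width_le_hi (T.col i)).trans_lt T.hi_lt
  have hfix : T.width (T.col i) * ξ + T.left (T.col i) = ξ := by
    rw [← T.c_zero, ← T.a_zero, hT.c_eq, hT.a_eq]
    exact S.fixedPoint_eq i (σ 0)
  have hmemK : ∀ p ∈ F, coords σ p ∈ T.K := fun p hp => hT.K_eq ▸ ⟨p, hp, rfl⟩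
  have hmap : ∀ i p l, coords σ (S.map i p) l = boxMap (T.c i) (T.a i) (coords σ p) l := by
    intro i p l
    simp only [boxMap, hT.c_eq, hT.a_eq]
    rfl
  have hmap0 : ∀ i p, S.map i p (σ 0) = T.width (T.col i) * p (σ 0) + T.left (T.col i) := by
    intro i p
    rw [← T.c_zero, ← T.a_zero, hT.c_eq, hT.a_eq]
    rfl
  have hmap1 : ∀ i p, S.map i p (σ 1) = T.c i 1 * p (σ 1) + T.a i 1 := by
    intro i p
    rw [hT.c_eq, hT.a_eq]
    rfl
  have hcube : ∀ x ∈ φ '' S.slice (σ 0) i F, ∀ j, 0 ≤ x j ∧ x j ≤ 1 := by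
    rintro _ ⟨p, hp, rfl⟩ j
    exact T.K_cube _ (hmemK p hp.1) 1
  rw [AffineIFS.slice_eq] at hcube ⊢
  have hpack : ∀ δ, 0 < δ → δ ≤ 1 →
      PackGe (φ '' {p ∈ F | p (σ 0) = ξ}) (fun _ => δ) (T.lo ^ t * δ ^ (-t)) := by
    intro δ h0 h1
    refine packGe_selfSimilar (I := {i' // T.col i' = T.col i}) (c := fun i => T.c i 1)
      (a := fun i => T.a i 1) T.lo_pos T.hi_lt (fun i => ⟨T.lo_le i 1, T.le_hi i 1⟩)
      (fun i => T.a_nonneg i 1) (fun i => T.add_le i 1)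
      (fun i i' h => T.sep_row i i' (fun e => h (Subtype.ext e)) (i.2.trans i'.2.symm)) ht htsum.ge
      ?_ hcube ?_ h0 h1
    · exact ⟨_, _, ⟨hF.fixedPoint_mem i, rfl⟩, rfl⟩
    · rintro ⟨i', hi'⟩ _ ⟨p, ⟨hp, hpξ⟩, rfl⟩
      refine ⟨S.map i' p, ⟨hF.map_mem i' hp, ?_⟩, ?_⟩
      · rw [hmap0, hi', hpξ, hfix]
      · funext _
        exact hmap1 i' p
  have hcover : ∀ δ, 0 < δ → δ ≤ 1 / T.lo →
      CoverLe (φ '' {p ∈ F | p (σ 0) = ξ}) (fun _ => δ) (T.lo ^ (-t) * δ ^ (-t)) := by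
    intro δ h0 h1
    refine coverLe_selfSimilar (I := {i' // T.col i' = T.col i}) (c := fun i => T.c i 1)
      (a := fun i => T.a i 1) T.lo_pos T.hi_lt (fun i => ⟨T.lo_le i 1, T.le_hi i 1⟩)
      ht htsum.le hcube ?_ h0 h1
    rintro _ ⟨p, ⟨hp, hpξ⟩, rfl⟩
    obtain ⟨i', q, hq, rfl⟩ := hF.exists_preimage hp
    have hq0 : 0 ≤ q (σ 0) ∧ q (σ 0) ≤ 1 := T.K_cube _ (hmemK q hq) 0
    have hi' : T.col i' = T.col i := by
      by_contra hne
      rw [hmap0] at hpξ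
      have hw' := T.width_pos (T.col i')
      have h1 := T.left_nonneg (T.col i')
      have h2 := T.left_add_width_le (T.col i')
      have h3 := T.left_nonneg (T.col i)
      have h4 := T.left_add_width_le (T.col i)
      have h5 := mul_nonneg hw'.le hq0.1
      have h6 := mul_le_of_le_one_right hw'.le hq0.2
      have h7 : 0 ≤ ξ := by linarith
      have h8 : ξ ≤ 1 := by linarith
      have h9 := mul_nonneg hw.le h7
      have h10 := mul_le_of_le_one_right hw.le h8
      rcases T.sep_col _ _ hne with h | h
      · -- the common end point is the left end of the column, hence `ξ = 0`
        have e : T.width (T.col i) * ξ = 0 := by linarith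
        rcases mul_eq_zero.1 e with e | e <;> linarith
      · -- the common end point is the right end of the column, hence `ξ = 1`
        have e : T.width (T.col i) * (1 - ξ) = 0 := by linarith
        rcases mul_eq_zero.1 e with e | e <;> linarith
    refine ⟨⟨i', hi'⟩, φ q, ⟨q, ⟨hq, ?_⟩, rfl⟩, ?_⟩
    · rw [hmap0, hi'] at hpξ
      exact mul_left_cancel₀ hw.ne' (by linarith)
    · funext _
      exact (hmap1 i' q).symm
  refine hasBoxDim_of_bounds (A := T.lo ^ t / 7) (B := T.lo ^ (-t) * (1 / 5) ^ (-t))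
    (by positivity) (by positivity) (fun r h0 h1 => ?_) (fun r h0 h1 => ?_)
  · have := PackGe.le_coverNumber (φ := φ) (fun x y _ => abs_coord_sub_le x y (σ 1)) h0 1 h0.le
      (by simp) (hpack r h0 h1.le)
    convert! this using 2
    norm_num
    ring
  · have := CoverLe.coverNumber_le (r := r) (φ := φ) (δ := r / 5) (fun x hx y hy h => by
        refine (dist_le_of_coords σ (δ := r / 5) (by positivity)
          (Fin.forall_fin_two.2 ⟨?_, h ()⟩)).trans_lt (by linarith)
        simp only [coords]
        rw [hx.2, hy.2, sub_self, abs_zero]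
        positivity) (hcover (r / 5) (by positivity) (by
          rw [le_div_iff₀ hlo]
          nlinarith [T.lo_lt_one]))
    convert! this using 2
    rw [div_eq_mul_one_div r 5, Real.mul_rpow h0.le (by norm_num)]
    ring

end BoxDimensions

/-! ### The lower dimension -/

section LowerDimension

variable {ι κ : Type*} {S : AffineIFS ι} {F : Set Plane} {σ : Equiv.Perm (Fin 2)}
  {T : ColumnCarpet ι κ}

lemma lowerDim_eq {X : Type*} [PseudoMetricSpace X] {F : Set X} {D : ℝ} (h : D ∈ lowerExponents F)
    (h' : ∀ α ∈ lowerExponents F, α ≤ D) : lowerDim F = (D : EReal) := by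
  refine le_antisymm (sSup_le ?_) (le_sSup ⟨D, h, rfl⟩)
  rintro _ ⟨α, hα, rfl⟩
  exact EReal.coe_le_coe_iff.2 (h' α hα)

namespace AffineIFS.Models

/-- Transfer of uniform packing bounds in boxes to covering numbers of balls. -/
lemma mem_lowerExponents (hT : S.Models F σ T) {C lam₀ D : ℝ} (hC : 0 < C) (hlam₀ : 1 ≤ lam₀)
    (hD : 0 ≤ D) (h : ∀ lam, lam₀ ≤ lam → ∀ x ∈ T.K, ∀ R : ℝ, 0 < R → R ≤ 1 →
      PackGe (inBox T.K x fun _ => R) (fun _ => R / lam) (C * lam ^ D)) :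
    D ∈ lowerExponents F := by
  obtain ⟨L, hL⟩ := exists_nat_ge (2 * lam₀)
  refine ⟨C / (2 * L + 5) ^ 2, by positivity, 1, one_pos, fun r R hr hrR hR1 x hx => ?_⟩
  have hR : 0 < R := hr.trans hrR
  have hRr : 1 ≤ R / r := (one_le_div hr).2 hrR.le
  have hlam : lam₀ ≤ lam₀ * (R / r) := le_mul_of_one_le_right (by linarith) hRr
  have h1 := h _ hlam (coords σ x) (hT.K_eq ▸ ⟨x, hx, rfl⟩) (R / 2) (by positivity) (by linarith)
  have e : R / 2 / (lam₀ * (R / r)) = r / (2 * lam₀) := by field_simp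
  rw [e] at h1
  have h2 : PackGe (coords σ '' (Metric.closedBall x R ∩ F)) (fun _ => r / (2 * lam₀))
      (C * (R / r) ^ D) := by
    refine h1.mono ?_ ?_
    · rintro p ⟨hp, hpR⟩
      rw [hT.K_eq] at hp
      obtain ⟨y, hy, rfl⟩ := hp
      refine ⟨y, ⟨?_, hy⟩, rfl⟩
      have := dist_le_of_coords σ (by positivity) hpR
      rw [Metric.mem_closedBall]
      linarith
    · gcongr
      exact le_mul_of_one_le_left (by positivity) hlam₀
  have h3 := h2.le_coverNumber (r := r) (abs_coords_sub_le σ) (by positivity) L hr.le (by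
    rw [← mul_div_assoc, le_div_iff₀ (by positivity)]
    nlinarith)
  rw [Fintype.card_fin] at h3
  convert! h3 using 2
  ring

lemma le_of_mem_lowerExponents [Fintype ι] [Fintype κ] [DecidableEq κ] (hT : S.Models F σ T)
    {s t : ℝ} (hs : 0 ≤ s) (ht : 0 ≤ t) (hsum : ∑ k, T.width k ^ s = 1) (k : κ)
    (htsum : ∑ i : {i // T.col i = k}, T.c i 1 ^ t = 1) (hstrict : ∃ i, T.c i 1 < T.c i 0) {α : ℝ}
    (hα : α ∈ lowerExponents F) : α ≤ s + t := by
  obtain ⟨i₀, hi₀⟩ := hstrict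
  -- the rectangle of least height in the column of a rectangle that is wider than high
  have : Nonempty {i // T.col i = T.col i₀} := ⟨⟨i₀, rfl⟩⟩
  obtain ⟨⟨i, hi⟩, hmin⟩ := Finite.exists_min fun i : {i // T.col i = T.col i₀} => T.c i 1
  have hi' : T.c i 1 < T.c i 0 := by
    rw [T.c_zero, hi, ← T.c_zero]
    exact (hmin ⟨i₀, rfl⟩).trans_lt hi₀
  obtain ⟨C, hC, hcov⟩ := T.exists_coverLe_inBox hs ht hsum.le k htsum.le hi'
    (fun i' h => hmin ⟨i', h.trans hi⟩)
  obtain ⟨A, hA, ρ, hρ, hlow⟩ := hα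
  have key : ∀ x : ℝ, 1 < x → A * x ^ α ≤ C * (5 * x) ^ (s + t) := by
    intro x hx
    have hx0 : 0 < x := by linarith
    obtain ⟨R, hR, hRρ, q, hq, hqcov⟩ := hcov (5 * x) ρ (by linarith) hρ
    rw [hT.K_eq] at hq
    obtain ⟨p, hp, rfl⟩ := hq
    have h1 := hlow (R / x) R (by positivity) (div_lt_self hR hx) hRρ p hp
    rw [div_div_cancel₀ hR.ne'] at h1
    have h2 : CoverLe (coords σ '' (Metric.closedBall p R ∩ F)) (fun _ => R / (5 * x))
        (C * (5 * x) ^ (s + t)) := by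
      refine hqcov.mono ?_ le_rfl
      rintro _ ⟨y, ⟨hyR, hy⟩, rfl⟩
      exact ⟨hT.K_eq ▸ ⟨y, hy, rfl⟩, fun l => (abs_coords_sub_le σ y p l).trans hyR⟩
    have h3 := h2.coverNumber_le (r := R / x) (fun u _ v _ h => by
      refine (dist_le_of_coords σ (by positivity) h).trans_lt ?_
      rw [← div_div, div_right_comm]
      have : 0 < R / x := by positivity
      linarith)
    exact (ENNReal.ofReal_le_ofReal_iff (by positivity)).1 (h1.trans h3)
  by_contra! hlt
  have hlim := (tendsto_rpow_atTop (sub_pos.2 hlt)).eventually_gt_atTop (C * 5 ^ (s + t) / A)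
  obtain ⟨x, hx, hx1⟩ := (hlim.and (eventually_gt_atTop 1)).exists
  have hx0 : 0 < x := by linarith
  have h1 := key x hx1
  rw [Real.rpow_sub hx0, div_lt_div_iff₀ hA (by positivity)] at hx
  rw [Real.mul_rpow (by norm_num) hx0.le] at h1
  nlinarith

lemma exists_dims [Fintype ι] [Fintype κ] [DecidableEq κ] (hF : S.IsAttractor F)
    (hT : S.Models F σ T) : ∃ (s : ℝ) (t : κ → ℝ), 0 ≤ s ∧ (∀ k, 0 ≤ t k) ∧
      ∑ k, T.width k ^ s = 1 ∧ (∀ k, ∑ i : {i // T.col i = k}, T.c i 1 ^ t k = 1) ∧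
      HasBoxDim (proj (σ 0) F) s ∧ ∀ i, HasBoxDim (S.slice (σ 0) i F) (t (T.col i)) := by
  have hκ : Nonempty κ := by
    obtain ⟨x, hx⟩ := T.K_ne
    exact ⟨T.col (T.exists_preimage hx).choose⟩
  obtain ⟨s, hs, hsum⟩ := exists_sum_rpow_eq_one (c := T.width) fun k =>
    ⟨T.width_pos k, (T.width_le_hi k).trans_lt T.hi_lt⟩
  have : ∀ k, ∃ t : ℝ, 0 ≤ t ∧ ∑ i : {i // T.col i = k}, T.c i 1 ^ t = 1 := by
    intro k
    have : Nonempty {i // T.col i = k} := by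
      obtain ⟨i, hi⟩ := T.col_surj k
      exact ⟨⟨i, hi⟩⟩
    exact exists_sum_rpow_eq_one fun i => ⟨T.c_pos _ _, (T.le_hi _ _).trans_lt T.hi_lt⟩
  choose t ht htsum using this
  exact ⟨s, t, hs, ht, hsum, htsum, hT.hasBoxDim_proj hs hsum,
    fun i => hT.hasBoxDim_slice hF (ht _) i (htsum _)⟩

/-- The smallest slice dimension is an exponent admitted in every sum over a column. -/
lemma one_le_sum_rpow_iInf [Fintype ι] [Nonempty ι] [DecidableEq κ] {t : κ → ℝ}
    (htsum : ∀ k, ∑ i : {i // T.col i = k}, T.c i 1 ^ t k = 1) (k : κ) :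
    1 ≤ ∑ i : {i // T.col i = k}, T.c i 1 ^ (⨅ i, t (T.col i)) := by
  rw [← htsum k]
  refine Finset.sum_le_sum fun i _ => ?_
  refine Real.rpow_le_rpow_of_exponent_ge (T.c_pos _ _) ((T.le_hi _ _).trans T.hi_lt.le) ?_
  obtain ⟨i, hi⟩ := i
  exact hi ▸ ciInf_le (Set.finite_range _).bddBelow i

/-- The dimension formula for carpets all of whose rectangles are at least as wide as high. -/
lemma lowerDim_of_wide [Fintype ι] [Fintype κ] [DecidableEq κ] (hF : S.IsAttractor F)
    (hT : S.Models F σ T) (hwide : ∀ i, T.c i 1 ≤ T.c i 0) (hstrict : ∃ i, T.c i 1 < T.c i 0) :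
    ∃ (s : ℝ) (t : ι → ℝ), HasBoxDim (proj (σ 0) F) s ∧
      (∀ i, HasBoxDim (S.slice (σ 0) i F) (t i)) ∧
      lowerDim F = ((s + ⨅ i, t i : ℝ) : EReal) := by
  have : Nonempty ι := ⟨hstrict.choose⟩
  obtain ⟨s, t, hs, ht, hsum, htsum, hproj, hslice⟩ := hT.exists_dims hF
  have hm : 0 ≤ ⨅ i, t (T.col i) := le_ciInf fun i => ht _
  have hlo := T.lo_pos
  refine ⟨s, fun i => t (T.col i), hproj, hslice, lowerDim_eq ?_ fun α hα => ?_⟩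
  · refine hT.mem_lowerExponents (lam₀ := 1 / T.lo)
      (C := T.lo ^ s * T.lo ^ s * T.lo ^ (⨅ i, t (T.col i)) * T.lo ^ (⨅ i, t (T.col i)))
      (by positivity) (by rw [le_div_iff₀ hlo]; linarith [T.lo_lt_one]) (by linarith)
      fun lam hlam x hx R hR hR1 => ?_
    refine T.packGe_zoom (P := fun α => 0 < α 0 ∧ α 0 ≤ α 1) (α := fun _ => R) ?_
      ((by positivity : 0 < 1 / T.lo).trans_le hlam) ?_ hx (fun _ => ⟨hR, hR1⟩) ⟨hR, le_rfl⟩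
    · intro α i hα
      exact ⟨div_pos hα.1 (T.c_pos i 0),
        div_le_div₀ (hα.1.le.trans hα.2) hα.2 (T.c_pos i 1) (hwide i)⟩
    · intro x hx α hα hα01 h1
      exact T.packGe_inBox hs hm hsum.ge (one_le_sum_rpow_iInf htsum) hx hα
        (h1.elim (fun h => h.trans hα01.2) id) hlam
  · rw [← sub_le_iff_le_add']
    refine le_ciInf fun i => ?_
    rw [sub_le_iff_le_add']
    exact hT.le_of_mem_lowerExponents hs (ht _) hsum _ (htsum _) hstrict hα

end AffineIFS.Models

/-- The dimension formula in the mixed case: a box about a point of the carpet is zoomed in until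
one of its sides reaches the unit scale, and is then a strip in one of the two directions. -/
lemma lowerDim_of_mixed {κ' : Type*} [Fintype ι] [Fintype κ] [DecidableEq κ] [Fintype κ']
    [DecidableEq κ'] (hF : S.IsAttractor F) {T : ColumnCarpet ι κ} {T' : ColumnCarpet ι κ'}
    (hT : S.Models F (Equiv.refl _) T) (hT' : S.Models F (Equiv.swap 0 1) T')
    (hwide : ∃ i, S.ratio i 1 < S.ratio i 0) (hhigh : ∃ i, S.ratio i 0 < S.ratio i 1) :
    ∃ (s : Fin 2 → ℝ) (t : Fin 2 → ι → ℝ), (∀ j, HasBoxDim (proj j F) (s j)) ∧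
      (∀ j i, HasBoxDim (S.slice j i F) (t j i)) ∧
      lowerDim F = ((⨅ i, ⨅ j, (s j + t j i) : ℝ) : EReal) := by
  have : Nonempty ι := ⟨hwide.choose⟩
  have hlo := T.lo_pos
  obtain ⟨s, t, hs, ht, hsum, htsum, hproj, hslice⟩ := hT.exists_dims hF
  obtain ⟨s', t', hs', ht', hsum', htsum', hproj', hslice'⟩ := hT'.exists_dims hF
  have hlo' : T'.lo = T.lo := hT'.lo_eq.trans hT.lo_eq.symm
  set m := ⨅ i, t (T.col i) with hmdef
  set m' := ⨅ i, t' (T'.col i) with hmdef'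
  have hm : 0 ≤ m := le_ciInf fun i => ht _
  have hm' : 0 ≤ m' := le_ciInf fun i => ht' _
  set u : Fin 2 → ι → ℝ := ![fun i => s + t (T.col i), fun i => s' + t' (T'.col i)] with hu
  have e : ∀ i j, ![s, s'] j + ![fun i => t (T.col i), fun i => t' (T'.col i)] j i = u j i := by
    intro i
    exact Fin.forall_fin_two.2 ⟨rfl, rfl⟩
  refine ⟨![s, s'], ![fun i => t (T.col i), fun i => t' (T'.col i)],
    Fin.forall_fin_two.2 ⟨hproj, hproj'⟩, Fin.forall_fin_two.2 ⟨hslice, hslice'⟩, ?_⟩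
  simp only [e]
  set D := ⨅ i, ⨅ j, u j i with hD
  have hDle : ∀ i j, D ≤ u j i := fun i j =>
    (ciInf_le (Set.finite_range _).bddBelow i).trans (ciInf_le (Set.finite_range _).bddBelow j)
  have hD0 : 0 ≤ D := le_ciInf fun i => le_ciInf (Fin.forall_fin_two.2
    ⟨add_nonneg hs (ht _), add_nonneg hs' (ht' _)⟩)
  have hDm : D ≤ s + m := by
    obtain ⟨i, hi⟩ := exists_eq_ciInf_of_finite (f := fun i => t (T.col i))
    rw [hmdef, ← hi]
    exact hDle i 0
  have hDm' : D ≤ s' + m' := by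
    obtain ⟨i, hi⟩ := exists_eq_ciInf_of_finite (f := fun i => t' (T'.col i))
    rw [hmdef', ← hi]
    exact hDle i 1
  refine lowerDim_eq ?_ fun α hα => ?_
  · refine hT.mem_lowerExponents (lam₀ := 1 / T.lo)
      (C := min (T.lo ^ s * T.lo ^ s * T.lo ^ m * T.lo ^ m)
        (T.lo ^ s' * T.lo ^ s' * T.lo ^ m' * T.lo ^ m'))
      (by positivity) (by rw [le_div_iff₀ hlo]; linarith [T.lo_lt_one]) hD0
      fun lam hlam x hx R hR hR1 => ?_
    have hlam1 : 1 ≤ lam :=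
      (show 1 ≤ 1 / T.lo by rw [le_div_iff₀ hlo]; linarith [T.lo_lt_one]).trans hlam
    refine T.packGe_zoom (P := fun _ => True) (α := fun _ => R) (fun _ _ _ => trivial)
      (by linarith) ?_ hx (fun _ => ⟨hR, hR1⟩) trivial
    intro x hx α hα _ h1
    rcases h1 with h1 | h1
    · have hx' : x ∘ Equiv.swap 0 1 ∈ T'.K := by
        rw [hT.K_eq] at hx
        obtain ⟨p, hp, rfl⟩ := hx
        rw [hT'.K_eq]
        exact ⟨p, hp, rfl⟩
      have := (T'.packGe_inBox hs' hm' hsum'.ge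
        (AffineIFS.Models.one_le_sum_rpow_iInf htsum') hx' (α := α ∘ Equiv.swap 0 1)
        (fun l => hlo' ▸ hα _) (by simpa using h1) (hlo' ▸ hlam)).reindex (Equiv.swap 0 1)
      have e1 : (fun l => (α ∘ Equiv.swap 0 1) l / lam) ∘ Equiv.swap 0 1 = fun l => α l / lam := by
        funext l
        simp
      rw [e1, hlo'] at this
      refine this.mono ?_ ?_
      · rintro _ ⟨p, ⟨hp, hpx⟩, rfl⟩
        rw [hT'.K_eq] at hp
        obtain ⟨y, hy, rfl⟩ := hp
        refine ⟨?_, fun l => by simpa using hpx (Equiv.swap 0 1 l)⟩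
        rw [hT.K_eq]
        exact ⟨y, hy, by funext l; simp [coords]⟩
      · gcongr
        exact min_le_right _ _
    · refine (T.packGe_inBox hs hm hsum.ge (AffineIFS.Models.one_le_sum_rpow_iInf htsum) hx hα h1
        hlam).mono le_rfl ?_
      gcongr
      exact min_le_left _ _
  · refine le_ciInf fun i => le_ciInf (Fin.forall_fin_two.2 ⟨?_, ?_⟩)
    · refine hT.le_of_mem_lowerExponents hs (ht _) hsum _ (htsum _) ?_ hα
      simpa only [hT.c_eq, Equiv.refl_apply] using hwide
    · refine hT'.le_of_mem_lowerExponents hs' (ht' _) hsum' _ (htsum' _) ?_ hα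
      simpa only [hT'.c_eq, Equiv.swap_apply_left, Equiv.swap_apply_right] using hhigh

end LowerDimension

section Classes

variable {ι : Type*} {S : AffineIFS ι} {F : Set Plane}

lemma AffineIFS.IsExtendedLalleyGatzouras.exists_models [Finite ι] {σ : Equiv.Perm (Fin 2)}
    (h : S.IsExtendedLalleyGatzouras (σ 0) (σ 1)) (hF : S.IsAttractor F) :
    ∃ (n : ℕ) (k : ι → Fin n) (T : ColumnCarpet ι (Set.range k)), S.Models F σ T := by
  obtain ⟨P, Q, cell, -, hinj, hcell⟩ := h
  refine ⟨P.n, fun i => (cell i).1, AffineIFS.exists_models hF σ P _ (fun i => (hcell i).1) ?_ ?_⟩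
  · intro i
    rw [(hcell i).2.1.1, (hcell i).2.1.2]
    exact ⟨(Q _).left_nonneg _, (Q _).left_add_length_le_one _⟩
  · intro i i' hne hk
    rw [(hcell i).2.1.1, (hcell i).2.1.2, (hcell i').2.1.1, (hcell i').2.1.2]
    have hcc : cell i ≠ cell i' := fun e => hne (hinj e)
    generalize cell i = x at *
    generalize cell i' = y at *
    obtain ⟨k, a⟩ := x
    obtain ⟨k', b⟩ := y
    obtain rfl : k = k' := hk
    exact (Q k).sep fun e => hcc (Sigma.ext rfl (heq_of_eq e))

lemma AffineIFS.IsBaranski.exists_models [Finite ι] (h : S.IsBaranski) (hF : S.IsAttractor F) :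
    (∃ (n : ℕ) (k : ι → Fin n) (T : ColumnCarpet ι (Set.range k)),
      S.Models F (Equiv.refl _) T) ∧
    (∃ (n : ℕ) (k : ι → Fin n) (T : ColumnCarpet ι (Set.range k)),
      S.Models F (Equiv.swap 0 1) T) := by
  obtain ⟨P, Q, cell, -, -, hinj, hcell⟩ := h
  constructor
  · refine ⟨P.n, fun i => (cell i).1, AffineIFS.exists_models hF _ P _ (fun i => (hcell i).1) ?_ ?_⟩
    · intro i
      rw [Equiv.refl_apply, (hcell i).2.1, (hcell i).2.2]
      exact ⟨Q.left_nonneg _, Q.left_add_length_le_one _⟩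
    · intro i i' hne hk
      rw [Equiv.refl_apply, (hcell i).2.1, (hcell i).2.2, (hcell i').2.1, (hcell i').2.2]
      exact Q.sep fun e => hne (hinj (Prod.ext hk e))
  · refine ⟨Q.n, fun i => (cell i).2, AffineIFS.exists_models hF _ Q _ (fun i => (hcell i).2) ?_ ?_⟩
    · intro i
      rw [Equiv.swap_apply_right, (hcell i).1.1, (hcell i).1.2]
      exact ⟨P.left_nonneg _, P.left_add_length_le_one _⟩
    · intro i i' hne hk
      rw [Equiv.swap_apply_right, (hcell i).1.1, (hcell i).1.2, (hcell i').1.1, (hcell i').1.2]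
      exact P.sep fun e => hne (hinj (Prod.ext e hk))

lemma AffineIFS.IsCarpetSystem.exists_ratio_ne (h : S.IsCarpetSystem) :
    ∃ i, S.ratio i 0 ≠ S.ratio i 1 := by
  obtain ⟨-, i, hi⟩ := h
  refine ⟨i, fun e => hi ⟨S.ratio i 0, fun p q => ?_⟩⟩
  have h0 := (S.ratio_mem i 0).1.le
  rw [EuclideanSpace.dist_eq, EuclideanSpace.dist_eq, Fin.sum_univ_two, Fin.sum_univ_two]
  simp only [AffineIFS.map_apply, ← e, Real.dist_eq, sq_abs]
  rw [← Real.sqrt_sq h0, ← Real.sqrt_mul (sq_nonneg _), Real.sqrt_sq h0]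
  congr 1
  ring

end Classes

end Carpet

end

theorem theorem2p9 {ι : Type*} [Finite ι] [Nontrivial ι] (S : Carpet.AffineIFS ι)
    (hS : S.IsCarpetSystem) (F : Set Carpet.Plane) (hF : S.IsAttractor F) :
    (S.IsHorizontal → ∃ (s : ℝ) (t : ι → ℝ),
      Carpet.HasBoxDim (Carpet.proj 0 F) s ∧ (∀ i, Carpet.HasBoxDim (S.slice 0 i F) (t i)) ∧
      Carpet.lowerDim F = ((s + ⨅ i, t i : ℝ) : EReal)) ∧
    (S.IsVertical → ∃ (s : ℝ) (t : ι → ℝ),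
      Carpet.HasBoxDim (Carpet.proj 1 F) s ∧ (∀ i, Carpet.HasBoxDim (S.slice 1 i F) (t i)) ∧
      Carpet.lowerDim F = ((s + ⨅ i, t i : ℝ) : EReal)) ∧
    (S.IsMixed → ∃ (s : Fin 2 → ℝ) (t : Fin 2 → ι → ℝ),
      (∀ j, Carpet.HasBoxDim (Carpet.proj j F) (s j)) ∧
      (∀ j i, Carpet.HasBoxDim (S.slice j i F) (t j i)) ∧
      Carpet.lowerDim F = ((⨅ i, ⨅ j, (s j + t j i) : ℝ) : EReal)) := by
  classical
  have := Fintype.ofFinite ι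
  obtain ⟨i₀, hi₀⟩ := hS.exists_ratio_ne
  refine ⟨fun hh => ?_, fun hv => ?_, fun hmix => ?_⟩
  · obtain ⟨n, k, T, hT⟩ : ∃ (n : ℕ) (k : ι → Fin n) (T : Carpet.ColumnCarpet ι (Set.range k)),
        S.Models F (Equiv.refl _) T := by
      rcases hS.1 with h | h | h
      · exact Carpet.AffineIFS.IsExtendedLalleyGatzouras.exists_models (σ := Equiv.refl _) h hF
      · obtain ⟨_, _, _, _, _, h⟩ := h
        exact absurd (le_antisymm (h i₀).2.2 (hh i₀)) hi₀
      · exact (h.exists_models hF).1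
    have h := hT.lowerDim_of_wide hF (fun i => by simpa only [hT.c_eq, Equiv.refl_apply] using hh i)
      ⟨i₀, by
        rw [hT.c_eq, hT.c_eq, Equiv.refl_apply, Equiv.refl_apply]
        exact lt_of_le_of_ne (hh i₀) hi₀.symm⟩
    rwa [Equiv.refl_apply] at h
  · obtain ⟨n, k, T, hT⟩ : ∃ (n : ℕ) (k : ι → Fin n) (T : Carpet.ColumnCarpet ι (Set.range k)),
        S.Models F (Equiv.swap 0 1) T := by
      rcases hS.1 with h | h | h
      · obtain ⟨_, _, _, _, _, h⟩ := h
        exact absurd (le_antisymm (hv i₀) (h i₀).2.2) hi₀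
      · exact Carpet.AffineIFS.IsExtendedLalleyGatzouras.exists_models (σ := Equiv.swap 0 1)
          (by rwa [Equiv.swap_apply_left, Equiv.swap_apply_right]) hF
      · exact (h.exists_models hF).2
    have h := hT.lowerDim_of_wide hF
      (fun i => by
        simpa only [hT.c_eq, Equiv.swap_apply_left, Equiv.swap_apply_right] using hv i)
      ⟨i₀, by
        rw [hT.c_eq, hT.c_eq, Equiv.swap_apply_left, Equiv.swap_apply_right]
        exact lt_of_le_of_ne (hv i₀) hi₀⟩
    rwa [Equiv.swap_apply_left] at h
  · have hwide : ∃ i, S.ratio i 1 < S.ratio i 0 := by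
      by_contra! h
      exact hmix.2 h
    have hhigh : ∃ i, S.ratio i 0 < S.ratio i 1 := by
      by_contra! h
      exact hmix.1 h
    rcases hS.1 with h | h | h
    · obtain ⟨_, _, _, _, _, h⟩ := h
      exact absurd (fun i => (h i).2.2) hmix.1
    · obtain ⟨_, _, _, _, _, h⟩ := h
      exact absurd (fun i => (h i).2.2) hmix.2
    · obtain ⟨⟨n, k, T, hT⟩, ⟨n', k', T', hT'⟩⟩ := h.exists_models hF
      exact Carpet.lowerDim_of_mixed hF hT hT' hwide hhigh
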